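/- Let $[N]=\{0,\dots,N-1\}$. For a probability distribution $D$ on $[N]$ and $S\subseteq[N]$ write $D(S)=\sum_{i\in S}D(i)$, and if $D(S)>0$ let $D_S(i)=D(i)/D(S)$ for $i\in S$ and $D_S(i)=0$ for $i\notin S$. For an integer $T\ge 1$, a map $O_D:\mathcal P([N])\times[T]\to[N]$ represents $D$ if $D_S(i)=|\{t\in[T]:O_D(S,t)=i\}|/T$ for all $i\in[N]$ and all $S\subseteq[N]$ with $D(S)>0$. A query to the oracle $\mathsf{QCOND}_D$ applies the unitary $U_D|S\rangle|t\rangle|\beta\rangle=|S\rangle|t\rangle|\beta+O_D(S,t)\bmod N\rangle$; it is a query on the set $A$ if the first register is in the state $|A\rangle$. A quantum query algorithm applies oracle-independent unitaries (possibly on additional work registers), queries, computational-basis measurements and classical control. In all bounds below put $\ell(\delta)=\log\frac{1}{\min(\delta,1/2)}$, which equals $\log(1/\delta)$ for $\delta\le 1/2$. There are an absolute constant $c>0$ and quantum query algorithms $\textsc{AddEstProbQCond}$ and $\textsc{MulEstProbQCond}$, each of which, given $N$, $T$, sets $R\subseteq S\subseteq[N]$, an integer $M\ge 0$ and $\delta\in(0,1]$,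 makes exactly $M$ queries to $\mathsf{QCOND}_D$, all on the set $S$, and outputs a real number $\tilde p$ such that, whenever $D(S)>0$ and with $p=D_S(R)$: - for $\textsc{AddEstProbQCond}$: $\mathbb P[|\tilde p-p|\le\epsilon]\ge 1-\delta$ for every $\epsilon>0$ with $M\ge c\,\ell(\delta)\max(\sqrt p/\epsilon,\,1/\sqrt\epsilon)$; - for $\textsc{MulEstProbQCond}$, if $p>0$: $\mathbb P[(1-\epsilon)p\le\tilde p\le(1+\epsilon)p]\ge 1-\delta$ for every $\epsilon\in(0,1]$ with $M\ge c\,\ell(\delta)/(\epsilon\sqrt p)$; and there is a choice of $M=M(K,\eta,\delta)=\Theta\big(\sqrt K\,\ell(\delta)/\eta\big)$ (with absolute implied constants) for which the following procedure has the properties stated below. $\textsc{QCompare}(D,X,Y,\eta,K,\delta)$. Input: $\mathsf{QCOND}_D$ access to $D$, disjoint $X,Y\subseteq[N]$ with $D(X\cup Y)>0$, real parameters $K\ge1$, $\eta\in(0,\frac{3}{8K})$, $\delta\in(0,1]$. Compute $\tilde w_+(X)$ and $\tilde w_+(Y)$ by $\textsc{AddEstProbQCond}$, and $\tilde w_\times(X)$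 and $\tilde w_\times(Y)$ by $\textsc{MulEstProbQCond}$, in separate runs with $S=X\cup Y$, $R=X$ or $R=Y$ respectively, $M$ queries and failure probability $\delta/4$. If $\tilde w_+(X)>\frac{3K}{3K+1}-\frac\eta3$, return Low; otherwise, if $\tilde w_+(Y)>\frac{3K}{3K+1}-\frac\eta3$, return High; otherwise return $\tilde r_{X,Y}=\tilde w_\times(Y)/\tilde w_\times(X)$. For every such input, $\textsc{QCompare}$ outputs Low, High, or a value $\tilde r_{X,Y}>0$. With $r_{X,Y}=D(Y)/D(X)\in[0,\infty]$ (equal to $\infty$ if $D(X)=0$): 1. if $1/K\le r_{X,Y}\le K$, then with probability at least $1-\delta$ it outputs a value $\tilde r_{X,Y}\in[1-\eta,1+\eta]\,r_{X,Y}$; 2. if $r_{X,Y}>K$, then with probability at least $1-\delta$ it outputs High or a value $\tilde r_{X,Y}\in[1-\eta,1+\eta]\,r_{X,Y}$ (a real value never counts as such if $r_{X,Y}=\infty$); 3. if $r_{X,Y}<1/K$, then with probability at least $1-\delta$ it outputs Low or a value $\tilde r_{X,Y}\in[1-\eta,1+\eta]\,r_{X,Y}$. It performs exactly $4M(K,\eta,\delta)=\Theta\big(\sqrt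 K\,\ell(\delta)/\eta\big)$ queries to $\mathsf{QCOND}_D$, all on the set $X\cup Y$; for $\delta\le1/2$ this is $\Theta\big(\sqrt K\log(1/\delta)/\eta\big)$. The implied constants are absolute (independent of $N,T,D,X,Y,K,\eta,\delta$). -/

import Mathlib

open scoped ENNReal

noncomputable section

/-- The weight `D(S) = ∑_{i ∈ S} D(i)`. -/
def weight {N : ℕ} (D : Fin N → ℝ) (S : Finset (Fin N)) : ℝ := ∑ i ∈ S, D i

/-- The conditional distribution `D_S` (meaningful when `D(S) > 0`). -/
def condDist {N : ℕ} (D : Fin N → ℝ) (S : Finset (Fin N)) (i : Fin N) : ℝ :=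
  if i ∈ S then D i / weight D S else 0

/-- The table `O_D : 𝒫([N]) × [T] → [N]` underlying a conditional sampling oracle. -/
abbrev OracleTable (N T : ℕ) : Type := Finset (Fin N) → Fin T → Fin N

/-- `O` represents `D`: for every `S` with `D(S) > 0` and every `i`,
`D_S(i) = |{t ∈ [T] : O(S, t) = i}| / T`. -/
def Represents {N T : ℕ} (O : OracleTable N T) (D : Fin N → ℝ) : Prop :=
  ∀ S : Finset (Fin N), 0 < weight D S → ∀ i : Fin N,
    condDist D S i = ((Finset.univ.filter fun t : Fin T => O S t = i).card : ℝ) / (T : ℝ)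

/-- Computational basis labels `(S, t, β, a)`: query-set register, `[T]`-register,
output register `[N]`, and a work register of arbitrary finite dimension `w`. -/
abbrev Basis (N T w : ℕ) : Type := Finset (Fin N) × Fin T × Fin N × Fin w

/-- The action of `QCOND_D` on basis labels: `(S, t, β, a) ↦ (S, t, β + O(S, t) mod N, a)`. -/
def oraclePerm {N T : ℕ} [NeZero N] (w : ℕ) (O : OracleTable N T) :
    Equiv.Perm (Basis N T w) where
  toFun b := (b.1, b.2.1, b.2.2.1 + O b.1 b.2.1, b.2.2.2)
  invFun b := (b.1, b.2.1, b.2.2.1 - O b.1 b.2.1, b.2.2.2)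
  left_inv b := by simp
  right_inv b := by simp

/-- The unitary `U_D`, i.e. the linear extension of `|b⟩ ↦ |oraclePerm b⟩`. -/
def applyOracle {N T w : ℕ} [NeZero N] (O : OracleTable N T) (ψ : Basis N T w → ℂ) :
    Basis N T w → ℂ :=
  fun b => ψ ((oraclePerm w O).symm b)

/-- A quantum query circuit: start in a basis state, apply
`gate 0, U_D, gate 1, U_D, …, U_D, gate queries`, and measure in the computational basis.
The gates are arbitrary unitaries that do not depend on the oracle. -/
structure Circuit (N T w : ℕ) where
  start : Basis N T w
  queries : ℕ
  gate : ℕ → Matrix.unitaryGroup (Basis N T w) ℂ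

namespace Circuit

variable {N T w : ℕ}

/-- The state after `gate k`, at which point `k` queries have been made. -/
def state [NeZero N] (C : Circuit N T w) (O : OracleTable N T) : ℕ → Basis N T w → ℂ
  | 0 => (C.gate 0 : Matrix (Basis N T w) (Basis N T w) ℂ).mulVec (Pi.single C.start 1)
  | k + 1 => (C.gate (k + 1) : Matrix (Basis N T w) (Basis N T w) ℂ).mulVec
      (applyOracle O (C.state O k))

theorem sum_sq_mulVec (U : Matrix.unitaryGroup (Basis N T w) ℂ) (ψ : Basis N T w → ℂ) :
    ∑ b, ‖(U : Matrix (Basis N T w) (Basis N T w) ℂ).mulVec ψ b‖ ^ 2 = ∑ b, ‖ψ b‖ ^ 2 := by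
  have key : ∀ φ : Basis N T w → ℂ, ((∑ b, ‖φ b‖ ^ 2 : ℝ) : ℂ) = star φ ⬝ᵥ φ := by
    intro φ
    rw [dotProduct]
    push_cast
    refine Finset.sum_congr rfl fun b _ => ?_
    simp only [Pi.star_apply]
    exact (RCLike.conj_mul (φ b)).symm
  have hU : (U : Matrix (Basis N T w) (Basis N T w) ℂ).conjTranspose
      * (U : Matrix (Basis N T w) (Basis N T w) ℂ) = 1 :=
    Matrix.mem_unitaryGroup_iff'.mp U.2
  have h : ((∑ b, ‖(U : Matrix (Basis N T w) (Basis N T w) ℂ).mulVec ψ b‖ ^ 2 : ℝ) : ℂ)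
      = ((∑ b, ‖ψ b‖ ^ 2 : ℝ) : ℂ) := by
    rw [key, key, Matrix.star_mulVec, Matrix.dotProduct_mulVec, Matrix.vecMul_vecMul, hU,
      Matrix.vecMul_one]
  exact_mod_cast h

theorem sum_sq_state [NeZero N] (C : Circuit N T w) (O : OracleTable N T) (k : ℕ) :
    ∑ b, ‖C.state O k b‖ ^ 2 = 1 := by
  induction k with
  | zero =>
    rw [state, sum_sq_mulVec, Finset.sum_eq_single C.start]
    · simp
    · intro b _ hb
      simp [hb]
    · simp
  | succ k ih =>
    rw [state, sum_sq_mulVec]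
    simp only [applyOracle]
    rw [Equiv.sum_comp (oraclePerm w O).symm (fun b => ‖C.state O k b‖ ^ 2)]
    exact ih

/-- The Born rule: the law of the measurement outcome of the final state. -/
def measure [NeZero N] (C : Circuit N T w) (O : OracleTable N T) : PMF (Basis N T w) :=
  PMF.ofFintype (fun b => ENNReal.ofReal (‖C.state O C.queries b‖ ^ 2)) (by
    rw [← ENNReal.ofReal_sum_of_nonneg fun b _ => by positivity, sum_sq_state,
      ENNReal.ofReal_one])

/-- Every query of the circuit is made on the query set `S`: whatever the oracle, just before
each query the state is supported on basis states whose query-set register is `S`. -/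
def QueriesOn [NeZero N] (C : Circuit N T w) (S : Finset (Fin N)) : Prop :=
  ∀ (O : OracleTable N T) (k : ℕ), k < C.queries →
    ∀ b : Basis N T w, b.1 ≠ S → C.state O k b = 0

end Circuit

/-- A quantum query algorithm with output in `α`: a classically controlled sequence of query
circuits; the outcome of each measurement determines how to continue. -/
inductive QAlg (N T : ℕ) (α : Type) : Type
  | ret (a : α) : QAlg N T α
  | run {w : ℕ} (C : Circuit N T w) (next : Basis N T w → QAlg N T α) : QAlg N T α

namespace QAlg

variable {N T : ℕ} {α β : Type}

/-- Sequential composition: run an algorithm and continue depending on its output. -/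
def bind : QAlg N T α → (α → QAlg N T β) → QAlg N T β
  | ret a, f => f a
  | run C next, f => run C fun b => (next b).bind f

/-- The law of the output of the algorithm when its queries are answered according to `O`. -/
def output [NeZero N] (O : OracleTable N T) : QAlg N T α → PMF α
  | ret a => PMF.pure a
  | run C next => (C.measure O).bind fun b => (next b).output O

/-- On every computation path the algorithm makes exactly `q` queries, all on the set `S`. -/
def MakesQueries [NeZero N] (S : Finset (Fin N)) : QAlg N T α → ℕ → Prop
  | ret _, q => q = 0
  | run C next, q =>
      C.QueriesOn S ∧ ∃ q', q = C.queries + q' ∧ ∀ b, (next b).MakesQueries S q'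

/-- The probability that the output lies in `E`. -/
def prob [NeZero N] (A : QAlg N T α) (O : OracleTable N T) (E : Set α) : ℝ≥0∞ :=
  (A.output O).toOuterMeasure E

end QAlg

/-- An estimation routine: from `N`, `T`, sets `S`, `R ⊆ [N]`, a number of queries `M` and a
failure probability `δ` it produces a quantum query algorithm with real output. The
distribution is accessible only through the oracle. -/
abbrev Estimator : Type :=
  ∀ N T : ℕ, Finset (Fin N) → Finset (Fin N) → ℕ → ℝ → QAlg N T ℝ

/-- Specification of `AddEstProbQCond` with constant `c`: exactly `M` queries, all on `S`, and
additive error at most `ε` with probability at least `1 - δ`, for every `ε > 0` such that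
`M ≥ c log(1/δ) max(√(D_S(R))/ε, 1/√ε)` (with `δ` capped at `1/2` inside the logarithm). -/
def IsAddEstProbQCond (c : ℝ) (A : Estimator) : Prop :=
  ∀ (N T : ℕ) [NeZero N] [NeZero T] (S R : Finset (Fin N)) (M : ℕ) (δ : ℝ),
    R ⊆ S → 0 < δ → δ ≤ 1 →
    (A N T S R M δ).MakesQueries S M ∧
    ∀ D ∈ stdSimplex ℝ (Fin N), ∀ O : OracleTable N T, Represents O D → 0 < weight D S →
      ∀ ε : ℝ, 0 < ε →
        c * Real.log (1 / min δ (1 / 2)) *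
          max (√(weight (condDist D S) R) / ε) (1 / √ε) ≤ (M : ℝ) →
        ENNReal.ofReal (1 - δ) ≤
          (A N T S R M δ).prob O {v | |v - weight (condDist D S) R| ≤ ε}

/-- Specification of `MulEstProbQCond` with constant `c`: exactly `M` queries, all on `S`, and
multiplicative error at most `ε` with probability at least `1 - δ`, for every `ε ∈ (0, 1]` such
that `M ≥ c log(1/δ) / (ε √(D_S(R)))` (with `δ` capped at `1/2` inside the logarithm);
nothing about the error is required when `D_S(R) = 0`. -/
def IsMulEstProbQCond (c : ℝ) (A : Estimator) : Prop :=
  ∀ (N T : ℕ) [NeZero N] [NeZero T] (S R : Finset (Fin N)) (M : ℕ) (δ : ℝ),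
    R ⊆ S → 0 < δ → δ ≤ 1 →
    (A N T S R M δ).MakesQueries S M ∧
    ∀ D ∈ stdSimplex ℝ (Fin N), ∀ O : OracleTable N T, Represents O D → 0 < weight D S →
      0 < weight (condDist D S) R →
      ∀ ε : ℝ, 0 < ε → ε ≤ 1 →
        c * Real.log (1 / min δ (1 / 2)) / (ε * √(weight (condDist D S) R)) ≤ (M : ℝ) →
        ENNReal.ofReal (1 - δ) ≤
          (A N T S R M δ).prob O {v | v ∈ Set.Icc
            ((1 - ε) * weight (condDist D S) R) ((1 + ε) * weight (condDist D S) R)}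

/-- The possible outputs of the comparison procedure. -/
inductive CompareOutput : Type
  | low : CompareOutput
  | high : CompareOutput
  | value (r : ℝ) : CompareOutput

/-- The procedure `QCompare(D, X, Y, η, K, δ)`, run with `M` queries per estimation; each of the
four estimations is given failure probability `δ / 4`. -/
def qCompare (addEst mulEst : Estimator) (M : ℕ) (N T : ℕ) (X Y : Finset (Fin N))
    (η K δ : ℝ) : QAlg N T CompareOutput :=
  (addEst N T (X ∪ Y) X M (δ / 4)).bind fun addX =>
  (addEst N T (X ∪ Y) Y M (δ / 4)).bind fun addY =>
  (mulEst N T (X ∪ Y) X M (δ / 4)).bind fun mulX =>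
  (mulEst N T (X ∪ Y) Y M (δ / 4)).bind fun mulY =>
  .ret (
    if ¬ addX ≤ 3 * K / (3 * K + 1) - η / 3 then .low
    else if ¬ addY ≤ 3 * K / (3 * K + 1) - η / 3 then .high
    else .value (mulY / mulX))

/-- The ratio `r_{X,Y} = D(Y) / D(X) ∈ [0, ∞]`, equal to `∞` if `D(X) = 0 < D(Y)`. -/
def ratio {N : ℕ} (D : Fin N → ℝ) (X Y : Finset (Fin N)) : ℝ≥0∞ :=
  ENNReal.ofReal (weight D Y) / ENNReal.ofReal (weight D X)

/-- The outputs that are values in `[1 - η, 1 + η] · r`. -/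
def goodValues (η : ℝ) (r : ℝ≥0∞) : Set CompareOutput :=
  {o | ∃ v : ℝ, 0 < v ∧ o = .value v ∧
    ENNReal.ofReal v ∈ Set.Icc (ENNReal.ofReal (1 - η) * r) (ENNReal.ofReal (1 + η) * r)}

end

/-! The label register $[T]$ turns conditional probabilities into counting: $p=D_S(R)$ is the
fraction of labels $t$ with $O_D(S,t)\in R$. On the uniform superposition of labels, amplitude
amplification is a rotation by $2\theta$ with $\sin^2\theta=p$. One iteration costs two queries: one
writes $O_D(S,t)$, and after a sign flip and a negation of the output register the other erases it.

A work register with amplitudes $\alpha_a$ controls that branch $a$ undergoes $a$ iterations. An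
inverse Fourier transform then gives an outcome $y$ whose law is the average of phase estimation at
$\theta$ and at $-\theta$ (`sum_norm_sq_estCircuit_state`). The estimate is $\sin^2(\pi y/P)$, with
$P$ the dimension of the work register.

Confidence $1-\delta$ comes from the choice of $\alpha$, not from medians of repeated runs. Take
$\alpha$ proportional to the coefficients of $(1+X+\dots+X^{L-1})^{m+1}$; the outcome law is then a
$2(m+1)$-th power of a Dirichlet kernel. Bounding $2m$ factors pointwise and summing the last two by
Parseval gives a tail $(m+1)(\mu L)^{-2m}$ beyond distance $\mu$ (`sum_phaseProb_windowAmp_le`).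
With $m\approx\ell(\delta)$, $L\approx M/(2(m+1))$ and $\mu=4/L$ the tail is at most $\delta$. The
circuit depends on $M$ and $\delta$ but not on $\epsilon$, so one algorithm serves every admissible
$\epsilon$. Multiplicative estimation is additive estimation with error $\epsilon p$.

For the comparison, the shares of $X$ and $Y$ in $X\cup Y$ add up to 1. A share of at most $K/(K+1)$
never passes the threshold, while a share above $3K/(3K+1)$ always does, up to the additive error
$\eta/4$. If neither share is below $1/(3K+1)$, both multiplicative estimates are accurate to
$\eta/3$ and their quotient is accurate to $\eta$; otherwise the larger share triggers Low or High.
-/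

noncomputable section

/-! ### Sequential composition: output laws, query counts, union bound -/

namespace QAlg

variable {N T : ℕ} {α β : Type}

theorem output_bind [NeZero N] (O : OracleTable N T) (A : QAlg N T α) (f : α → QAlg N T β) :
    (A.bind f).output O = (A.output O).bind fun a => (f a).output O := by
  induction A with
  | ret a => simp [bind, output, PMF.pure_bind]
  | run C next ih => simp [bind, output, PMF.bind_bind, ih]

theorem MakesQueries.bind [NeZero N] {S : Finset (Fin N)} {A : QAlg N T α}
    {f : α → QAlg N T β} {q r : ℕ} (hA : A.MakesQueries S q)
    (hf : ∀ a, (f a).MakesQueries S r) : (A.bind f).MakesQueries S (q + r) := by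
  induction A generalizing q with
  | ret a =>
    have : q = 0 := hA
    subst this
    simpa [QAlg.bind] using hf a
  | run C next ih =>
    obtain ⟨hC, q', rfl, hn⟩ := hA
    exact ⟨hC, q' + r, by ring, fun b => ih b (hn b)⟩

/-- The union bound for sequential composition. -/
theorem le_prob_bind [NeZero N] {O : OracleTable N T} {A : QAlg N T α} {f : α → QAlg N T β}
    {E : Set α} {F : Set β} {a b : ℝ} (ha : 0 ≤ a) (hb : 0 ≤ b)
    (hA : ENNReal.ofReal (1 - a) ≤ A.prob O E)
    (hf : ∀ x ∈ E, ENNReal.ofReal (1 - b) ≤ (f x).prob O F) :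
    ENNReal.ofReal (1 - (a + b)) ≤ (A.bind f).prob O F := by
  classical
  -- `ENNReal.ofReal` is multiplicative only for a nonnegative factor; if $1-a\le0$ the claimed
  -- bound is 0.
  rcases le_or_gt (1 - a) 0 with h1 | h1
  · rw [ENNReal.ofReal_of_nonpos (by linarith)]
    exact zero_le
  calc ENNReal.ofReal (1 - (a + b)) ≤ ENNReal.ofReal ((1 - a) * (1 - b)) :=
        ENNReal.ofReal_le_ofReal (by nlinarith)
    _ = ENNReal.ofReal (1 - a) * ENNReal.ofReal (1 - b) := ENNReal.ofReal_mul h1.le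
    _ ≤ A.prob O E * ENNReal.ofReal (1 - b) := by gcongr
    _ ≤ (A.bind f).prob O F := by
      rw [prob, prob, output_bind, PMF.toOuterMeasure_bind_apply, PMF.toOuterMeasure_apply,
        ← ENNReal.tsum_mul_right]
      refine ENNReal.tsum_le_tsum fun x => ?_
      by_cases hx : x ∈ E
      · rw [Set.indicator_of_mem hx]
        gcongr
        exact hf x hx
      · rw [Set.indicator_of_notMem hx, zero_mul]
        exact zero_le

theorem prob_ret [NeZero N] (O : OracleTable N T) {a : α} {E : Set α} (h : a ∈ E) :
    (ret a : QAlg N T α).prob O E = 1 := by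
  simp [prob, output, h]

end QAlg

/-! ### Unitary gates from norm-preserving maps -/

section Gates

variable {ι : Type} [Fintype ι] [DecidableEq ι]

/-- Polarisation recovers inner products from norms, so each gate needs only one identity between
sums of squares and no explicit adjoint. -/
theorem toMatrix'_mem_unitaryGroup {f : (ι → ℂ) →ₗ[ℂ] (ι → ℂ)}
    (hf : ∀ ψ, ∑ b, ‖f ψ b‖ ^ 2 = ∑ b, ‖ψ b‖ ^ 2) :
    LinearMap.toMatrix' f ∈ Matrix.unitaryGroup ι ℂ := by
  let g : EuclideanSpace ℂ ι →ₗᵢ[ℂ] EuclideanSpace ℂ ι :=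
    { toFun := fun v => WithLp.toLp 2 (f v.ofLp)
      map_add' := fun v w => by simp
      map_smul' := fun r v => by simp
      norm_map' := fun v => by
        have := hf v.ofLp
        simpa [EuclideanSpace.norm_eq] using congrArg Real.sqrt this }
  rw [Matrix.mem_unitaryGroup_iff']
  ext i j
  have h := g.inner_map_map (EuclideanSpace.single i 1) (EuclideanSpace.single j 1)
  rw [EuclideanSpace.inner_single_left] at h
  rw [Matrix.mul_apply, Matrix.one_apply]
  have h2 : (inner ℂ (g (EuclideanSpace.single i 1)) (g (EuclideanSpace.single j 1)) : ℂ)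
      = ∑ k, (star (LinearMap.toMatrix' f)) i k * LinearMap.toMatrix' f k j := by
    rw [PiLp.inner_apply]
    refine Finset.sum_congr rfl fun k _ => ?_
    simp [g, Matrix.star_apply, LinearMap.toMatrix'_apply, mul_comm]
  rw [← h2, h]
  simp

/-- The gate of a linear map that preserves the norm. -/
def isometryGate (f : (ι → ℂ) →ₗ[ℂ] (ι → ℂ)) (hf : ∀ ψ, ∑ b, ‖f ψ b‖ ^ 2 = ∑ b, ‖ψ b‖ ^ 2) :
    Matrix.unitaryGroup ι ℂ :=
  ⟨LinearMap.toMatrix' f, toMatrix'_mem_unitaryGroup hf⟩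

theorem isometryGate_mulVec (f : (ι → ℂ) →ₗ[ℂ] (ι → ℂ))
    (hf : ∀ ψ, ∑ b, ‖f ψ b‖ ^ 2 = ∑ b, ‖ψ b‖ ^ 2) (ψ : ι → ℂ) :
    (isometryGate f hf : Matrix ι ι ℂ).mulVec ψ = f ψ :=
  LinearMap.toMatrix'_mulVec f ψ

/-- Every unit vector can be prepared from every basis state. -/
theorem exists_gate_mulVec_single (i : ι) {ψ : ι → ℂ} (hψ : ∑ b, ‖ψ b‖ ^ 2 = 1) :
    ∃ U : Matrix.unitaryGroup ι ℂ, (U : Matrix ι ι ℂ).mulVec (Pi.single i 1) = ψ := by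
  have ho : Orthonormal ℂ (({i} : Set ι).domRestrict fun _ : ι => (WithLp.toLp 2 ψ :
      EuclideanSpace ℂ ι)) := by
    constructor
    · intro _
      simp [EuclideanSpace.norm_eq, Set.domRestrict, hψ]
    · rintro ⟨a, rfl⟩ ⟨b, rfl⟩ hab
      exact absurd rfl hab
  -- Extend `ψ` to an orthonormal basis indexed by `ι` with `ψ` at position `i`; the change of basis
  -- is the gate.
  obtain ⟨e, he⟩ := ho.exists_orthonormalBasis_extension_of_card_eq (by simp)
  let f : (ι → ℂ) →ₗ[ℂ] (ι → ℂ) :=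
    { toFun := fun φ => (e.repr.symm (WithLp.toLp 2 φ)).ofLp
      map_add' := fun v w => by simp
      map_smul' := fun r v => by simp }
  have hf : ∀ φ, ∑ b, ‖f φ b‖ ^ 2 = ∑ b, ‖φ b‖ ^ 2 := fun φ => by
    have h := e.repr.symm.norm_map (WithLp.toLp 2 φ)
    have h2 := congrArg (· ^ 2) h
    simp only [EuclideanSpace.norm_sq_eq] at h2
    exact h2
  refine ⟨isometryGate f hf, ?_⟩
  rw [isometryGate_mulVec]
  change (e.repr.symm (EuclideanSpace.single i 1)).ofLp = ψ
  rw [e.repr_symm_single, he i rfl]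

end Gates

/-! ### Discrete Fourier transform -/

section Fourier

/-- The phases of the discrete Fourier transform are orthogonal. -/
theorem sum_exp_mul_sub {P : ℕ} (a b : Fin P) :
    ∑ y : Fin P, Complex.exp (2 * Real.pi * Complex.I * (((a : ℕ) : ℂ) - ((b : ℕ) : ℂ)) *
      ((y : ℕ) : ℂ) / P) = if a = b then (P : ℂ) else 0 := by
  have hP : P ≠ 0 := fun h => by subst h; exact a.elim0
  have hPc : (P : ℂ) ≠ 0 := by exact_mod_cast hP
  split_ifs with hab
  · subst hab
    simp
  set r : ℂ := Complex.exp (2 * Real.pi * Complex.I * (((a : ℕ) : ℂ) - ((b : ℕ) : ℂ)) / P) with hr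
  have h1 : r ^ P = 1 := by
    rw [hr, ← Complex.exp_nat_mul, Complex.exp_eq_one_iff]
    refine ⟨(a : ℤ) - (b : ℤ), ?_⟩
    push_cast
    field_simp
  have h2 : r ≠ 1 := by
    intro h
    rw [hr, Complex.exp_eq_one_iff] at h
    obtain ⟨n, hn⟩ := h
    have h3 : (((a : ℕ) : ℂ) - ((b : ℕ) : ℂ)) = n * P := by
      have hpi : (2 * Real.pi * Complex.I : ℂ) ≠ 0 := Complex.two_pi_I_ne_zero
      field_simp at hn
      linear_combination hn
    have h4 : ((a : ℕ) : ℤ) - ((b : ℕ) : ℤ) = n * P := by exact_mod_cast h3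
    have ha := a.2
    have hb := b.2
    have hn0 : n = 0 := by
      by_contra hn0
      rcases lt_or_gt_of_ne hn0 with h | h <;> nlinarith
    subst hn0
    exact hab (Fin.ext (by simp at h4; omega))
  have h3 : ∀ y : Fin P, Complex.exp (2 * Real.pi * Complex.I * (((a : ℕ) : ℂ) - ((b : ℕ) : ℂ)) *
      ((y : ℕ) : ℂ) / P) = r ^ (y : ℕ) := fun y => by
    rw [hr, ← Complex.exp_nat_mul]
    congr 1
    ring
  simp_rw [h3]
  rw [Fin.sum_univ_eq_sum_range (fun n => r ^ n), geom_sum_eq h2, h1]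
  simp

/-- Parseval's identity for the discrete Fourier transform. -/
theorem sum_norm_sq_fourier {P : ℕ} (c : Fin P → ℂ) :
    ∑ y : Fin P, ‖∑ a : Fin P,
      Complex.exp (-(2 * Real.pi * Complex.I * ((y : ℕ) : ℂ) * ((a : ℕ) : ℂ) / P)) * c a‖ ^ 2
    = P * ∑ a, ‖c a‖ ^ 2 := by
  have key : ((∑ y : Fin P, ‖∑ a : Fin P,
      Complex.exp (-(2 * Real.pi * Complex.I * ((y : ℕ) : ℂ) * ((a : ℕ) : ℂ) / P)) * c a‖ ^ 2 : ℝ)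
      : ℂ) = ((P * ∑ a, ‖c a‖ ^ 2 : ℝ) : ℂ) := by
    push_cast
    simp_rw [← Complex.conj_mul', map_sum, Finset.sum_mul_sum, map_mul, ← Complex.exp_conj]
    calc _ = ∑ a, ∑ b, ((starRingEnd ℂ) (c a) * c b) * ∑ y : Fin P, Complex.exp (2 * Real.pi *
            Complex.I * (((a : ℕ) : ℂ) - ((b : ℕ) : ℂ)) * ((y : ℕ) : ℂ) / P) := by
          rw [Finset.sum_comm]
          refine Finset.sum_congr rfl fun a _ => ?_
          rw [Finset.sum_comm]
          refine Finset.sum_congr rfl fun b _ => ?_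
          rw [Finset.mul_sum]
          refine Finset.sum_congr rfl fun y _ => ?_
          rw [mul_mul_mul_comm, ← Complex.exp_add, mul_comm]
          congr 2
          simp [map_ofNat]
          ring
      _ = _ := by
          simp_rw [sum_exp_mul_sub]
          simp [Finset.mul_sum, mul_comm]
  exact_mod_cast key

end Fourier

/-! ### Gates of amplitude estimation -/

theorem sum_norm_sq_reflection {T : ℕ} [NeZero T] (φ : Fin T → ℂ) :
    ∑ t, ‖(2 / T : ℂ) * ∑ s, φ s - φ t‖ ^ 2 = ∑ t, ‖φ t‖ ^ 2 := by
  have hT : (T : ℂ) ≠ 0 := by exact_mod_cast NeZero.ne T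
  set c : ℂ := (2 / T : ℂ) * ∑ s, φ s with hc
  have hs : ∑ s, φ s = ((T : ℝ) / 2) • c := by
    rw [hc, Complex.real_smul]
    push_cast
    field_simp
  simp_rw [@norm_sub_sq_real ℂ]
  rw [Finset.sum_add_distrib, Finset.sum_sub_distrib, ← Finset.mul_sum, ← inner_sum, hs,
    inner_smul_right, real_inner_self_eq_norm_sq]
  simp
  ring

section AmplitudeGates

variable {N T w : ℕ}

theorem sum_basis {β : Type} [AddCommMonoid β] (g : Basis N T w → β) :
    ∑ b, g b = ∑ A, ∑ x, ∑ a, ∑ t, g (A, t, x, a) := by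
  rw [Fintype.sum_prod_type]
  refine Finset.sum_congr rfl fun A _ => ?_
  rw [Fintype.sum_prod_type, Finset.sum_comm' (t' := Finset.univ) (s' := fun _ => Finset.univ)
    (by simp), Fintype.sum_prod_type]

theorem sum_basis' {β : Type} [AddCommMonoid β] (g : Basis N T w → β) :
    ∑ b, g b = ∑ A, ∑ x, ∑ t, ∑ a, g (A, t, x, a) := by
  rw [sum_basis]
  exact Finset.sum_congr rfl fun A _ => Finset.sum_congr rfl fun x _ => Finset.sum_comm

/-- Negation of the output register. -/
def negPerm [NeZero N] : Equiv.Perm (Basis N T w) where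
  toFun b := (b.1, b.2.1, -b.2.2.1, b.2.2.2)
  invFun b := (b.1, b.2.1, -b.2.2.1, b.2.2.2)
  left_inv b := by simp
  right_inv b := by simp

/-- Negation of the output register, preceded by a sign flip of the labels in `R`, controlled on
the work register exceeding `m`. -/
def phaseMap [NeZero N] (R : Finset (Fin N)) (m : ℕ) :
    (Basis N T w → ℂ) →ₗ[ℂ] (Basis N T w → ℂ) where
  toFun ψ b := (if -b.2.2.1 ∈ R ∧ m < b.2.2.2 then -1 else 1) * ψ (negPerm b)
  map_add' ψ φ := by ext b; simp [mul_add]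
  map_smul' r ψ := by ext b; simp [mul_left_comm]

theorem sum_norm_sq_phaseMap [NeZero N] (R : Finset (Fin N)) (m : ℕ) (ψ : Basis N T w → ℂ) :
    ∑ b, ‖phaseMap R m ψ b‖ ^ 2 = ∑ b, ‖ψ b‖ ^ 2 := by
  rw [← Equiv.sum_comp negPerm fun b => ‖ψ b‖ ^ 2]
  refine Finset.sum_congr rfl fun b _ => ?_
  simp only [phaseMap, LinearMap.coe_mk, AddHom.coe_mk]
  split_ifs <;> simp

/-- Reflection of the `[T]`-register about the uniform superposition, controlled on the work
register exceeding `m`. -/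
def diffusionMap (m : ℕ) : (Basis N T w → ℂ) →ₗ[ℂ] (Basis N T w → ℂ) where
  toFun ψ b := if m < b.2.2.2 then (2 / T : ℂ) * ∑ t, ψ (b.1, t, b.2.2.1, b.2.2.2) - ψ b else ψ b
  map_add' ψ φ := by
    ext b
    simp only [Pi.add_apply, Finset.sum_add_distrib]
    split_ifs <;> ring
  map_smul' r ψ := by
    ext b
    simp only [Pi.smul_apply, smul_eq_mul, RingHom.id_apply, ← Finset.mul_sum]
    split_ifs <;> ring

theorem sum_norm_sq_diffusionMap [NeZero T] (m : ℕ) (ψ : Basis N T w → ℂ) :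
    ∑ b, ‖diffusionMap m ψ b‖ ^ 2 = ∑ b, ‖ψ b‖ ^ 2 := by
  rw [sum_basis, sum_basis]
  refine Finset.sum_congr rfl fun A _ => Finset.sum_congr rfl fun x _ =>
    Finset.sum_congr rfl fun a _ => ?_
  simp only [diffusionMap, LinearMap.coe_mk, AddHom.coe_mk]
  split_ifs
  · exact sum_norm_sq_reflection fun t => ψ (A, t, x, a)
  · rfl

/-- The inverse Fourier transform of the work register. -/
def fourierMap : (Basis N T w → ℂ) →ₗ[ℂ] (Basis N T w → ℂ) where
  toFun ψ b := ((1 / √w : ℝ) : ℂ) * ∑ a : Fin w, Complex.exp (-(2 * Real.pi * Complex.I *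
    ((b.2.2.2 : ℕ) : ℂ) * ((a : ℕ) : ℂ) / w)) * ψ (b.1, b.2.1, b.2.2.1, a)
  map_add' ψ φ := by
    ext b
    simp only [Pi.add_apply, mul_add, Finset.sum_add_distrib]
  map_smul' r ψ := by
    ext b
    simp only [Pi.smul_apply, smul_eq_mul, RingHom.id_apply, Finset.mul_sum]
    exact Finset.sum_congr rfl fun _ _ => by ring

theorem sum_norm_sq_fourierMap [NeZero w] (ψ : Basis N T w → ℂ) :
    ∑ b, ‖fourierMap ψ b‖ ^ 2 = ∑ b, ‖ψ b‖ ^ 2 := by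
  have hw : (0 : ℝ) < w := by exact_mod_cast NeZero.pos w
  rw [sum_basis', sum_basis']
  refine Finset.sum_congr rfl fun A _ => Finset.sum_congr rfl fun x _ =>
    Finset.sum_congr rfl fun t _ => ?_
  simp only [fourierMap, LinearMap.coe_mk, AddHom.coe_mk, norm_mul, mul_pow]
  rw [← Finset.mul_sum, sum_norm_sq_fourier fun a => ψ (A, t, x, a), Complex.norm_real,
    Real.norm_eq_abs, sq_abs, div_pow, Real.sq_sqrt hw.le]
  field_simp

end AmplitudeGates

/-! ### Amplitude amplification as a rotation -/

section Grover

/-- The amplitudes of the marked and of the unmarked labels after `m` Grover iterations, when the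
marked labels have weight `p` and all amplitudes start at `s`. -/
def groverAmp (p s : ℝ) : ℕ → ℝ × ℝ
  | 0 => (s, s)
  | m + 1 => ((1 - 2 * p) * (groverAmp p s m).1 + 2 * (1 - p) * (groverAmp p s m).2,
      -2 * p * (groverAmp p s m).1 + (1 - 2 * p) * (groverAmp p s m).2)

/-- Each iteration rotates by $2\theta$. The factors $\sin\theta$ and $\cos\theta$ stay on the left
so that $p=0$ and $p=1$ need no separate treatment. -/
theorem groverAmp_eq_sin_cos (θ s : ℝ) (m : ℕ) :
    Real.sin θ * (groverAmp (Real.sin θ ^ 2) s m).1 = s * Real.sin ((2 * m + 1) * θ) ∧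
    Real.cos θ * (groverAmp (Real.sin θ ^ 2) s m).2 = s * Real.cos ((2 * m + 1) * θ) := by
  induction m with
  | zero => simp [groverAmp, mul_comm]
  | succ m ih =>
    obtain ⟨h1, h2⟩ := ih
    have h3 : (2 * ((m + 1 : ℕ) : ℝ) + 1) * θ = (2 * m + 1) * θ + 2 * θ := by push_cast; ring
    rw [h3, Real.sin_add, Real.cos_add, Real.sin_two_mul, Real.cos_two_mul]
    have h4 := Real.sin_sq_add_cos_sq θ
    simp only [groverAmp]
    constructor
    · linear_combination (2 * Real.cos θ ^ 2 - 1) * h1 + 2 * Real.sin θ * Real.cos θ * h2 +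
        (-2 * Real.sin θ * (groverAmp (Real.sin θ ^ 2) s m).1
          - 2 * Real.sin θ * (groverAmp (Real.sin θ ^ 2) s m).2) * h4
    · linear_combination (2 * Real.cos θ ^ 2 - 1) * h2 - 2 * Real.sin θ * Real.cos θ * h1 -
        2 * Real.cos θ * (groverAmp (Real.sin θ ^ 2) s m).2 * h4

end Grover

/-! ### Evolution of the estimation circuit and the law of its outcome -/

section Evolution

variable {N T J : ℕ}

/-- The fraction of the `[T]`-labels that the oracle maps into `R`. -/
def markedFraction (O : OracleTable N T) (S R : Finset (Fin N)) : ℝ :=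
  ((Finset.univ.filter fun t => O S t ∈ R).card : ℝ) / T

/-- The amplitude of the label `t` after `m` Grover iterations. -/
def labelAmp (O : OracleTable N T) (S R : Finset (Fin N)) (m : ℕ) (t : Fin T) : ℝ :=
  if O S t ∈ R then (groverAmp (markedFraction O S R) (1 / √T) m).1
  else (groverAmp (markedFraction O S R) (1 / √T) m).2

theorem sum_labels_ite [NeZero T] (O : OracleTable N T) (S R : Finset (Fin N)) (x y : ℝ) :
    ∑ t, (if O S t ∈ R then x else y) =
      T * (markedFraction O S R * x + (1 - markedFraction O S R) * y) := by
  have hT : (T : ℝ) ≠ 0 := by exact_mod_cast NeZero.ne T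
  have h := Finset.card_filter_add_card_filter_not (s := (Finset.univ : Finset (Fin T)))
    (fun t => O S t ∈ R)
  rw [Finset.card_univ, Fintype.card_fin] at h
  have h' : ((Finset.univ.filter fun t => O S t ∈ R).card : ℝ) +
    ((Finset.univ.filter fun t => ¬ O S t ∈ R).card : ℝ) = T := by exact_mod_cast h
  rw [Finset.sum_ite, Finset.sum_const, Finset.sum_const, nsmul_eq_mul, nsmul_eq_mul,
    markedFraction]
  field_simp
  linear_combination y * h'

theorem labelAmp_zero (O : OracleTable N T) (S R : Finset (Fin N)) (t : Fin T) :
    labelAmp O S R 0 t = 1 / √T := by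
  simp [labelAmp, groverAmp]

theorem labelAmp_succ [NeZero T] (O : OracleTable N T) (S R : Finset (Fin N)) (m : ℕ) (t : Fin T) :
    2 / T * ∑ s, (if O S s ∈ R then -1 else 1) * labelAmp O S R m s -
      (if O S t ∈ R then -1 else 1) * labelAmp O S R m t = labelAmp O S R (m + 1) t := by
  have hT : (T : ℝ) ≠ 0 := by exact_mod_cast NeZero.ne T
  have h : ∀ s, (if O S s ∈ R then -1 else 1) * labelAmp O S R m s =
      if O S s ∈ R then -(groverAmp (markedFraction O S R) (1 / √T) m).1
        else (groverAmp (markedFraction O S R) (1 / √T) m).2 := fun s => by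
    rw [labelAmp]
    split_ifs <;> ring
  simp_rw [h]
  rw [sum_labels_ite, labelAmp]
  simp only [groverAmp]
  split_ifs <;> field_simp <;> ring

variable [NeZero N]

/-- The state of the amplitude estimation circuit after `n` queries, before the final Fourier
transform. -/
def estState (O : OracleTable N T) (S R : Finset (Fin N)) (α : Fin (J + 1) → ℝ) (n : ℕ) :
    Basis N T (J + 1) → ℂ := fun b =>
  if n % 2 = 0 then
    if b.1 = S ∧ b.2.2.1 = 0 then
      ((α b.2.2.2 * labelAmp O S R (min b.2.2.2 (n / 2)) b.2.1 : ℝ) : ℂ) else 0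
  else
    if b.1 = S ∧ b.2.2.1 = -O S b.2.1 then
      ((α b.2.2.2 * ((if O S b.2.1 ∈ R ∧ n / 2 < b.2.2.2 then -1 else 1) *
        labelAmp O S R (min b.2.2.2 (n / 2)) b.2.1) : ℝ) : ℂ) else 0

/-- The initial state of the amplitude estimation circuit. -/
def initState (S : Finset (Fin N)) (α : Fin (J + 1) → ℝ) : Basis N T (J + 1) → ℂ := fun b =>
  if b.1 = S ∧ b.2.2.1 = 0 then ((α b.2.2.2 * (1 / √T) : ℝ) : ℂ) else 0

theorem estState_zero (O : OracleTable N T) (S R : Finset (Fin N)) (α : Fin (J + 1) → ℝ) :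
    estState O S R α 0 = initState S α := by
  ext b
  simp [estState, initState, labelAmp_zero]

theorem sum_norm_sq_initState [NeZero T] (S : Finset (Fin N)) {α : Fin (J + 1) → ℝ}
    (hα : ∑ a, α a ^ 2 = 1) : ∑ b, ‖(initState S α : Basis N T (J + 1) → ℂ) b‖ ^ 2 = 1 := by
  have hT : (0 : ℝ) < T := by exact_mod_cast NeZero.pos T
  rw [sum_basis, Finset.sum_eq_single S, Finset.sum_eq_single 0]
  · simp only [initState, and_self, if_true, Complex.norm_real, Real.norm_eq_abs, sq_abs, mul_pow,
      Finset.sum_const, Finset.card_univ, Fintype.card_fin, nsmul_eq_mul, div_pow,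
      Real.sq_sqrt hT.le]
    refine Eq.trans (Finset.sum_congr rfl fun a _ => ?_) hα
    field_simp
  · intro x _ hx
    simp [initState, hx]
  · simp
  · intro A _ hA
    simp [initState, hA]
  · simp

/-- The oracle can only add. Negating the output register after the first query lets the second one
return it to 0, so no inverse query is needed. -/
theorem phaseMap_estState (O : OracleTable N T) (S R : Finset (Fin N)) (α : Fin (J + 1) → ℝ)
    (m : ℕ) : phaseMap R m (applyOracle O (estState O S R α (2 * m))) =
      estState O S R α (2 * m + 1) := by
  ext ⟨A, t, x, a⟩
  have h1 : (2 * m + 1) / 2 = m := by omega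
  have h2 : 2 * m / 2 = m := by omega
  have h3 : (2 * m + 1) % 2 ≠ 0 := by omega
  have h4 : 2 * m % 2 = 0 := by omega
  simp only [phaseMap, LinearMap.coe_mk, AddHom.coe_mk, applyOracle, oraclePerm, negPerm,
    Equiv.coe_fn_mk, Equiv.coe_fn_symm_mk, estState, h1, h2, h3, h4, if_true, if_false]
  by_cases hA : A = S
  · subst hA
    by_cases hx : x = -O A t
    · subst hx
      simp only [neg_neg, sub_self, and_self, if_true]
      split_ifs <;> push_cast <;> ring
    · have hx' : ¬ (-x - O A t = 0) := fun h => hx (by rw [sub_eq_zero] at h; rw [← h, neg_neg])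
      simp [hx, hx']
  · simp [hA]

theorem diffusionMap_estState [NeZero T] (O : OracleTable N T) (S R : Finset (Fin N))
    (α : Fin (J + 1) → ℝ) (m : ℕ) :
    diffusionMap m (applyOracle O (estState O S R α (2 * m + 1))) =
      estState O S R α (2 * m + 2) := by
  ext ⟨A, t, x, a⟩
  have h1 : (2 * m + 1) / 2 = m := by omega
  have h2 : (2 * m + 2) / 2 = m + 1 := by omega
  have h3 : (2 * m + 1) % 2 ≠ 0 := by omega
  have h4 : (2 * m + 2) % 2 = 0 := by omega
  simp only [diffusionMap, LinearMap.coe_mk, AddHom.coe_mk, applyOracle, oraclePerm,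
    Equiv.coe_fn_symm_mk, estState, h1, h2, h3, h4, if_true, if_false]
  by_cases hA : A = S
  · subst hA
    have hx : ∀ s, x - O A s = -O A s ↔ x = 0 := fun s => by
      rw [sub_eq_add_neg, add_eq_right]
    simp only [hx, true_and]
    by_cases hx0 : x = 0
    · simp only [hx0, if_true]
      by_cases ha : m < a
      -- Branches with `m < a` undergo one more iteration; in the others the two queries cancel and
      -- nothing else acts.
      · simp only [ha, if_true, and_true, min_eq_right ha.le, min_eq_right (Nat.succ_le_of_lt ha)]
        rw [← labelAmp_succ]
        push_cast
        rw [← Finset.mul_sum]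
        ring
      · have ha' : (a : ℕ) ≤ m := not_lt.mp ha
        simp [ha, min_eq_left ha', min_eq_left (Nat.le_succ_of_le ha')]
    · simp [hx0]
  · simp [hA]

variable [NeZero T]

/-- A gate that prepares `ψ` from the basis state `i`. -/
def prepGate {ι : Type} [Fintype ι] [DecidableEq ι] (i : ι) (ψ : ι → ℂ) :
    Matrix.unitaryGroup ι ℂ :=
  open Classical in
  if h : ∑ b, ‖ψ b‖ ^ 2 = 1 then (exists_gate_mulVec_single i h).choose else 1

theorem prepGate_mulVec {ι : Type} [Fintype ι] [DecidableEq ι] (i : ι) {ψ : ι → ℂ}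
    (h : ∑ b, ‖ψ b‖ ^ 2 = 1) :
    (prepGate i ψ : Matrix ι ι ℂ).mulVec (Pi.single i 1) = ψ := by
  rw [prepGate, dif_pos h]
  exact (exists_gate_mulVec_single i h).choose_spec

/-- The gates of the amplitude estimation circuit other than the final Fourier transform. -/
def groverGate (S R : Finset (Fin N)) (α : Fin (J + 1) → ℝ) :
    ℕ → Matrix.unitaryGroup (Basis N T (J + 1)) ℂ
  | 0 => prepGate (S, 0, 0, 0) (initState S α)
  | n + 1 => if n % 2 = 0 then isometryGate (phaseMap R (n / 2)) (sum_norm_sq_phaseMap R _)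
      else isometryGate (diffusionMap (n / 2)) (sum_norm_sq_diffusionMap _)

/-- Amplitude estimation with `2 * J` queries on the set `S`, where the phase register is prepared
in the state with amplitudes `α`. -/
def estCircuit (N T : ℕ) [NeZero N] [NeZero T] {J : ℕ} (S R : Finset (Fin N))
    (α : Fin (J + 1) → ℝ) : Circuit N T (J + 1) where
  start := (S, 0, 0, 0)
  queries := 2 * J
  gate n := (if n = 2 * J then isometryGate fourierMap sum_norm_sq_fourierMap else 1) *
    groverGate S R α n

theorem groverGate_succ_mulVec (O : OracleTable N T) (S R : Finset (Fin N))
    (α : Fin (J + 1) → ℝ) (n : ℕ) :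
    (groverGate (T := T) S R α (n + 1) : Matrix (Basis N T (J + 1)) (Basis N T (J + 1)) ℂ).mulVec
      (applyOracle O (estState O S R α n)) = estState O S R α (n + 1) := by
  obtain ⟨m, rfl | rfl⟩ := Nat.even_or_odd' n
  · have h1 : 2 * m % 2 = 0 := by omega
    have h2 : 2 * m / 2 = m := by omega
    rw [groverGate, if_pos h1, isometryGate_mulVec, h2, phaseMap_estState]
  · have h1 : (2 * m + 1) % 2 ≠ 0 := by omega
    have h2 : (2 * m + 1) / 2 = m := by omega
    rw [groverGate, if_neg h1, isometryGate_mulVec, h2, diffusionMap_estState]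

theorem estCircuit_gate_mulVec (S R : Finset (Fin N)) (α : Fin (J + 1) → ℝ) (n : ℕ)
    (ψ : Basis N T (J + 1) → ℂ) :
    ((estCircuit N T S R α).gate n : Matrix (Basis N T (J + 1)) (Basis N T (J + 1)) ℂ).mulVec ψ =
      if n = 2 * J then fourierMap ((groverGate (T := T) S R α n :
        Matrix (Basis N T (J + 1)) (Basis N T (J + 1)) ℂ).mulVec ψ)
      else (groverGate (T := T) S R α n : Matrix (Basis N T (J + 1)) (Basis N T (J + 1)) ℂ).mulVec ψ := by
  simp only [estCircuit]
  split_ifs with h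
  · rw [← isometryGate_mulVec fourierMap sum_norm_sq_fourierMap, Matrix.mulVec_mulVec]
    rfl
  · rw [one_mul]

theorem estCircuit_state (O : OracleTable N T) (S R : Finset (Fin N)) {α : Fin (J + 1) → ℝ}
    (hα : ∑ a, α a ^ 2 = 1) {n : ℕ} (hn : n ≤ 2 * J) :
    (estCircuit N T S R α).state O n =
      if n = 2 * J then fourierMap (estState O S R α n) else estState O S R α n := by
  induction n with
  | zero =>
    rw [Circuit.state, estCircuit_gate_mulVec, estState_zero]
    have : (groverGate (T := T) S R α 0 : Matrix (Basis N T (J + 1)) (Basis N T (J + 1)) ℂ).mulVec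
        (Pi.single (estCircuit N T S R α).start 1) = initState S α :=
      prepGate_mulVec _ (sum_norm_sq_initState S hα)
    rw [this]
  | succ n ih =>
    rw [Circuit.state, estCircuit_gate_mulVec, ih (by omega), if_neg (by omega : n ≠ 2 * J),
      groverGate_succ_mulVec]

theorem estCircuit_queriesOn (S R : Finset (Fin N)) {α : Fin (J + 1) → ℝ}
    (hα : ∑ a, α a ^ 2 = 1) : (estCircuit N T S R α).QueriesOn S := by
  intro O k hk b hb
  have hk' : k < 2 * J := hk
  rw [estCircuit_state O S R hα hk'.le, if_neg hk'.ne]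
  simp [estState, hb]

/-- The probability that phase estimation of the phase `2θ`, started with amplitudes `α`, returns
`y`. -/
def phaseProb (α : Fin (J + 1) → ℝ) (θ : ℝ) (y : Fin (J + 1)) : ℝ :=
  1 / (J + 1 : ℕ) * ‖∑ a, (α a : ℂ) * Complex.exp (-(2 * Real.pi * Complex.I *
    ((y : ℕ) : ℂ) * ((a : ℕ) : ℂ) / (J + 1 : ℕ))) * Complex.exp (2 * (a : ℕ) * θ * Complex.I)‖ ^ 2

/-- Up to the phases $e^{\pm i\theta}$, the two exponential sums are $u\pm iv$ with $u$ the cosine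
sum and $v$ the sine sum. By the parallelogram law, the eigenphases $\pm2\theta$ contribute with
weight one half each and without a cross term. -/
theorem norm_sq_sin_add_norm_sq_cos {ι : Type} [Fintype ι] (c : ι → ℂ) (n : ι → ℕ) (θ : ℝ) :
    ‖∑ a, c a * (Real.sin ((2 * n a + 1) * θ) : ℝ)‖ ^ 2 +
      ‖∑ a, c a * (Real.cos ((2 * n a + 1) * θ) : ℝ)‖ ^ 2 =
    (‖∑ a, c a * Complex.exp (2 * n a * θ * Complex.I)‖ ^ 2 +
      ‖∑ a, c a * Complex.exp (2 * n a * ((-θ : ℝ) : ℂ) * Complex.I)‖ ^ 2) / 2 := by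
  set u := ∑ a, c a * (Real.cos ((2 * n a + 1) * θ) : ℝ) with hu
  set v := ∑ a, c a * (Real.sin ((2 * n a + 1) * θ) : ℝ) with hv
  have h1 : ∀ φ : ℝ, ‖Complex.exp (φ * Complex.I)‖ = 1 := Complex.norm_exp_ofReal_mul_I
  have h2 : ‖∑ a, c a * Complex.exp (2 * n a * θ * Complex.I)‖ = ‖u + Complex.I * v‖ := by
    rw [← one_mul ‖∑ a, _‖, ← h1 θ, ← norm_mul, Finset.mul_sum, hu, hv, Finset.mul_sum,
      ← Finset.sum_add_distrib]
    congr 1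
    refine Finset.sum_congr rfl fun a _ => ?_
    have : Complex.exp (θ * Complex.I) * Complex.exp (2 * n a * θ * Complex.I) =
        Complex.exp (((2 * n a + 1) * θ : ℝ) * Complex.I) := by
      rw [← Complex.exp_add]; congr 1; push_cast; ring
    rw [mul_left_comm, this, Complex.exp_mul_I, ← Complex.ofReal_cos, ← Complex.ofReal_sin]
    ring
  have h3 : ‖∑ a, c a * Complex.exp (2 * n a * ((-θ : ℝ) : ℂ) * Complex.I)‖ =
      ‖u - Complex.I * v‖ := by
    rw [← one_mul ‖∑ a, _‖, ← h1 (-θ), ← norm_mul, Finset.mul_sum, hu, hv, Finset.mul_sum,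
      ← Finset.sum_sub_distrib]
    congr 1
    refine Finset.sum_congr rfl fun a _ => ?_
    have : Complex.exp (((-θ : ℝ) : ℂ) * Complex.I) *
        Complex.exp (2 * n a * ((-θ : ℝ) : ℂ) * Complex.I) =
        Complex.exp ((-((2 * n a + 1) * θ) : ℝ) * Complex.I) := by
      rw [← Complex.exp_add]; congr 1; push_cast; ring
    rw [mul_left_comm, this, Complex.exp_mul_I, ← Complex.ofReal_cos, ← Complex.ofReal_sin,
      Real.cos_neg, Real.sin_neg]
    push_cast
    ring
  have h4 := parallelogram_law_with_norm ℝ u (Complex.I * v)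
  rw [norm_mul, Complex.norm_I, one_mul] at h4
  rw [h2, h3]
  linarith

/-- The law of the phase register at the end of amplitude estimation. -/
theorem sum_norm_sq_estCircuit_state (O : OracleTable N T) (S R : Finset (Fin N))
    {α : Fin (J + 1) → ℝ} (hα : ∑ a, α a ^ 2 = 1) {θ : ℝ}
    (hθ : Real.sin θ ^ 2 = markedFraction O S R) (g : Fin (J + 1) → ℝ) :
    ∑ b, g b.2.2.2 * ‖(estCircuit N T S R α).state O (2 * J) b‖ ^ 2 =
      ∑ y, g y * ((phaseProb α θ y + phaseProb α (-θ) y) / 2) := by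
  have hT : (0 : ℝ) < T := by exact_mod_cast NeZero.pos T
  have hJ : (0 : ℝ) < ((J + 1 : ℕ) : ℝ) := by positivity
  rw [estCircuit_state O S R hα le_rfl, if_pos rfl, sum_basis, Finset.sum_eq_single S,
    Finset.sum_eq_single 0]
  rotate_left
  · intro x _ hx
    simp [fourierMap, estState, hx]
  · simp
  · intro A _ hA
    simp [fourierMap, estState, hA]
  · simp
  refine Finset.sum_congr rfl fun y _ => ?_
  simp only
  rw [← Finset.mul_sum]
  congr 1
  set e : Fin (J + 1) → ℂ := fun a => (α a : ℂ) * Complex.exp (-(2 * Real.pi * Complex.I *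
    ((y : ℕ) : ℂ) * ((a : ℕ) : ℂ) / (J + 1 : ℕ))) with he
  set X := ∑ a, e a * ((groverAmp (markedFraction O S R) (1 / √T) a).1 : ℂ) with hX
  set Y := ∑ a, e a * ((groverAmp (markedFraction O S R) (1 / √T) a).2 : ℂ) with hY
  have h1 : ∀ t, ‖fourierMap (estState O S R α (2 * J)) (S, t, 0, y)‖ ^ 2 =
      if O S t ∈ R then 1 / (J + 1 : ℕ) * ‖X‖ ^ 2 else 1 / (J + 1 : ℕ) * ‖Y‖ ^ 2 := by
    intro t
    -- After all $2J$ queries every branch has completed its `a` iterations.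
    have h2 : ∀ a : Fin (J + 1), min (a : ℕ) (2 * J / 2) = a := fun a => by
      have := a.2; omega
    have h3 : 2 * J % 2 = 0 := by omega
    simp only [fourierMap, LinearMap.coe_mk, AddHom.coe_mk, estState, h2, h3, and_self, if_true,
      norm_mul, mul_pow, Complex.norm_real, Real.norm_eq_abs, sq_abs, div_pow, one_pow,
      Real.sq_sqrt hJ.le, labelAmp]
    split_ifs
    all_goals
      congr 3
      refine Finset.sum_congr rfl fun a _ => ?_
      rw [he]
      push_cast
      ring
  simp_rw [h1]
  rw [sum_labels_ite, phaseProb, phaseProb]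
  have h5 := norm_sq_sin_add_norm_sq_cos e (fun a => (a : ℕ)) θ
  have hs : (1 / √(T : ℝ)) ^ 2 * T = 1 := by
    rw [div_pow, Real.sq_sqrt hT.le]
    field_simp
  have h6 : markedFraction O S R * ‖X‖ ^ 2 =
      (1 / √T) ^ 2 * ‖∑ a, e a * (Real.sin ((2 * (a : ℕ) + 1) * θ) : ℝ)‖ ^ 2 := by
    rw [← hθ, ← sq_abs (Real.sin θ), ← sq_abs (1 / √(T : ℝ)), ← mul_pow, ← mul_pow,
      ← Real.norm_eq_abs, ← Real.norm_eq_abs, ← Complex.norm_real, ← Complex.norm_real,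
      ← norm_mul, ← norm_mul, hX, Finset.mul_sum, Finset.mul_sum]
    congr 2
    refine Finset.sum_congr rfl fun a _ => ?_
    have := (groverAmp_eq_sin_cos θ (1 / √T) a).1
    rw [hθ] at this
    rw [mul_left_comm, ← Complex.ofReal_mul, this, Complex.ofReal_mul]
    ring
  have h7 : (1 - markedFraction O S R) * ‖Y‖ ^ 2 =
      (1 / √T) ^ 2 * ‖∑ a, e a * (Real.cos ((2 * (a : ℕ) + 1) * θ) : ℝ)‖ ^ 2 := by
    have hc : 1 - markedFraction O S R = Real.cos θ ^ 2 := by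
      rw [← hθ]; linarith [Real.sin_sq_add_cos_sq θ]
    rw [hc, ← sq_abs (Real.cos θ), ← sq_abs (1 / √(T : ℝ)), ← mul_pow, ← mul_pow,
      ← Real.norm_eq_abs, ← Real.norm_eq_abs, ← Complex.norm_real, ← Complex.norm_real,
      ← norm_mul, ← norm_mul, hY, Finset.mul_sum, Finset.mul_sum]
    congr 2
    refine Finset.sum_congr rfl fun a _ => ?_
    have := (groverAmp_eq_sin_cos θ (1 / √T) a).2
    rw [hθ] at this
    rw [mul_left_comm, ← Complex.ofReal_mul, this, Complex.ofReal_mul]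
    ring
  rw [← mul_add, mul_div_assoc, ← h5]
  linear_combination (1 / ((J + 1 : ℕ) : ℝ)) * T * (h6 + h7) +
    (1 / ((J + 1 : ℕ) : ℝ)) * (‖∑ a, e a * (Real.sin ((2 * (a : ℕ) + 1) * θ) : ℝ)‖ ^ 2 +
      ‖∑ a, e a * (Real.cos ((2 * (a : ℕ) + 1) * θ) : ℝ)‖ ^ 2) * hs

end Evolution

/-! ### The convolution window and its tail -/

section Window

open Polynomial

/-- The generating polynomial of the `(m + 1)`-fold convolution of a box of length `L`. -/
def windowPoly (m L : ℕ) : ℝ[X] := (∑ i ∈ Finset.range L, X ^ i) ^ (m + 1)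

/-- The degree bound of `windowPoly`. -/
abbrev windowDeg (m L : ℕ) : ℕ := (m + 1) * (L - 1)

/-- The square of the norm of the coefficients of `windowPoly`. -/
def windowNormSq (m L : ℕ) : ℝ := ∑ a : Fin (windowDeg m L + 1), (windowPoly m L).coeff a ^ 2

/-- The normalised coefficients of `windowPoly`. -/
def windowAmp (m L : ℕ) (a : Fin (windowDeg m L + 1)) : ℝ :=
  (windowPoly m L).coeff a / √(windowNormSq m L)

theorem natDegree_windowPoly_le (m L : ℕ) : (windowPoly m L).natDegree ≤ windowDeg m L := by
  refine natDegree_pow_le_of_le _ (natDegree_sum_le_of_forall_le _ _ fun i hi => ?_)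
  rw [natDegree_X_pow]
  have := Finset.mem_range.mp hi
  omega

theorem sum_coeff_windowPoly_mul_pow (m L : ℕ) (z : ℂ) :
    ∑ a : Fin (windowDeg m L + 1), ((windowPoly m L).coeff a : ℂ) * z ^ (a : ℕ) =
      (∑ i ∈ Finset.range L, z ^ i) ^ (m + 1) := by
  rw [Fin.sum_univ_eq_sum_range (fun a => ((windowPoly m L).coeff a : ℂ) * z ^ a)]
  have h := aeval_eq_sum_range' (Nat.lt_succ_of_le (natDegree_windowPoly_le m L)) z
  simp only [Algebra.smul_def] at h
  have h2 : aeval z (windowPoly m L) = (∑ i ∈ Finset.range L, z ^ i) ^ (m + 1) := by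
    simp [windowPoly]
  rw [← h2, h]
  rfl

/-- Cauchy–Schwarz for the coefficients, whose sum is the value $L^{m+1}$ of the polynomial at 1. -/
theorem le_windowNormSq (m L : ℕ) :
    (L : ℝ) ^ (2 * (m + 1)) ≤ (windowDeg m L + 1 : ℕ) * windowNormSq m L := by
  have h := sum_coeff_windowPoly_mul_pow m L 1
  simp only [one_pow, mul_one, Finset.sum_const, Finset.card_range, nsmul_eq_mul] at h
  have h1 : ∑ a : Fin (windowDeg m L + 1), (windowPoly m L).coeff a = (L : ℝ) ^ (m + 1) := by
    exact_mod_cast h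
  have h2 := sq_sum_le_card_mul_sum_sq (s := Finset.univ)
    (f := fun a : Fin (windowDeg m L + 1) => (windowPoly m L).coeff a)
  rw [h1, Finset.card_univ, Fintype.card_fin] at h2
  rw [mul_comm 2, pow_mul]
  exact h2

theorem windowNormSq_pos (m : ℕ) {L : ℕ} (hL : 0 < L) : 0 < windowNormSq m L := by
  have h := le_windowNormSq m L
  have h1 : (0 : ℝ) < (L : ℝ) ^ (2 * (m + 1)) := by positivity
  exact pos_of_mul_pos_right (h1.trans_le h) (by positivity)

theorem sum_windowAmp_sq (m : ℕ) {L : ℕ} (hL : 0 < L) : ∑ a, windowAmp m L a ^ 2 = 1 := by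
  have h := windowNormSq_pos m hL
  simp only [windowAmp, div_pow, Real.sq_sqrt h.le]
  rw [← Finset.sum_div]
  exact div_self h.ne'

/-- The phase difference seen by the outcome `y` of phase estimation of the phase `2θ`. -/
def phaseFactor (J : ℕ) (θ : ℝ) (y : ℕ) : ℂ :=
  Complex.exp ((2 * (θ - Real.pi * y / (J + 1 : ℕ)) : ℝ) * Complex.I)

theorem norm_one_sub_phaseFactor (J : ℕ) (θ : ℝ) (y : ℕ) :
    ‖1 - phaseFactor J θ y‖ = 2 * |Real.sin (θ - Real.pi * y / (J + 1 : ℕ))| := by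
  rw [norm_sub_rev, phaseFactor, mul_comm, Complex.norm_exp_I_mul_ofReal_sub_one, norm_mul,
    Real.norm_eq_abs, Real.norm_eq_abs]
  congr 3
  · norm_num
  · ring

theorem phaseProb_eq (J : ℕ) (α : Fin (J + 1) → ℝ) (θ : ℝ) (y : Fin (J + 1)) :
    phaseProb α θ y = 1 / (J + 1 : ℕ) * ‖∑ a, (α a : ℂ) * phaseFactor J θ y ^ (a : ℕ)‖ ^ 2 := by
  rw [phaseProb]
  congr 3
  refine Finset.sum_congr rfl fun a _ => ?_
  rw [mul_assoc, ← Complex.exp_add, phaseFactor, ← Complex.exp_nat_mul]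
  congr 2
  push_cast
  ring

/-- The amplitude of outcome `y` is the window polynomial evaluated at a point of the unit circle,
and that polynomial is a power of a geometric sum. -/
theorem phaseProb_windowAmp (m : ℕ) {L : ℕ} (hL : 0 < L) (θ : ℝ) (y : Fin (windowDeg m L + 1)) :
    phaseProb (windowAmp m L) θ y = 1 / ((windowDeg m L + 1 : ℕ) * windowNormSq m L) *
      ‖∑ i ∈ Finset.range L, phaseFactor (windowDeg m L) θ y ^ i‖ ^ (2 * (m + 1)) := by
  have h := windowNormSq_pos m hL
  rw [phaseProb_eq]
  have h1 : ∑ a, (windowAmp m L a : ℂ) * phaseFactor (windowDeg m L) θ y ^ (a : ℕ) =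
      ((1 / √(windowNormSq m L) : ℝ) : ℂ) *
        (∑ i ∈ Finset.range L, phaseFactor (windowDeg m L) θ y ^ i) ^ (m + 1) := by
    rw [← sum_coeff_windowPoly_mul_pow, Finset.mul_sum]
    refine Finset.sum_congr rfl fun a _ => ?_
    rw [windowAmp]
    push_cast
    ring
  rw [h1, norm_mul, norm_pow, mul_pow, Complex.norm_real, Real.norm_eq_abs, sq_abs, div_pow,
    Real.sq_sqrt h.le, ← pow_mul, mul_comm 2]
  field_simp

theorem norm_geom_sum_phaseFactor_mul_le (J L : ℕ) (θ : ℝ) (y : ℕ) :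
    ‖∑ i ∈ Finset.range L, phaseFactor J θ y ^ i‖ *
      |Real.sin (θ - Real.pi * y / (J + 1 : ℕ))| ≤ 1 := by
  have h1 := geom_sum_mul_neg (phaseFactor J θ y) L
  have h2 := congrArg norm h1
  rw [norm_mul, norm_one_sub_phaseFactor] at h2
  have h3 : ‖1 - phaseFactor J θ y ^ L‖ ≤ 2 := by
    refine (norm_sub_le _ _).trans ?_
    rw [norm_one, norm_pow, phaseFactor, Complex.norm_exp_ofReal_mul_I, one_pow]
    norm_num
  linarith

/-- Parseval for a modulated box of length `L`, padded with zeros to length `J + 1`. -/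
theorem sum_norm_sq_geom_sum_phaseFactor (J L : ℕ) (hL : L ≤ J + 1) (θ : ℝ) :
    ∑ y : Fin (J + 1), ‖∑ i ∈ Finset.range L, phaseFactor J θ y ^ i‖ ^ 2 = (J + 1 : ℕ) * L := by
  have h := sum_norm_sq_fourier fun a : Fin (J + 1) =>
    if (a : ℕ) < L then Complex.exp ((2 * (a : ℕ) * θ : ℝ) * Complex.I) else 0
  have h1 : ∑ a : Fin (J + 1), ‖(if (a : ℕ) < L then
      Complex.exp ((2 * (a : ℕ) * θ : ℝ) * Complex.I) else 0 : ℂ)‖ ^ 2 = L := by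
    have h2 : ∀ a : Fin (J + 1), ‖(if (a : ℕ) < L then
      Complex.exp ((2 * (a : ℕ) * θ : ℝ) * Complex.I) else 0 : ℂ)‖ ^ 2 =
        if (a : ℕ) < L then 1 else 0 := fun a => by
      split_ifs
      · rw [Complex.norm_exp_ofReal_mul_I, one_pow]
      · simp
    simp_rw [h2]
    rw [Fin.sum_univ_eq_sum_range (fun a => if a < L then (1 : ℝ) else 0), ← Finset.sum_filter]
    have : (Finset.range (J + 1)).filter (· < L) = Finset.range L := by
      ext i; simp; omega
    rw [this]
    simp
  rw [h1] at h
  rw [← h]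
  refine Finset.sum_congr rfl fun y _ => ?_
  congr 2
  rw [Fin.sum_univ_eq_sum_range (fun a => Complex.exp (-(2 * Real.pi * Complex.I *
    ((y : ℕ) : ℂ) * (a : ℂ) / (J + 1 : ℕ))) *
    if a < L then Complex.exp ((2 * a * θ : ℝ) * Complex.I) else 0)]
  have : Finset.range L = (Finset.range (J + 1)).filter (· < L) := by
    ext i; simp; omega
  rw [this, Finset.sum_filter]
  refine Finset.sum_congr rfl fun a _ => ?_
  split_ifs
  · rw [← Complex.exp_add, phaseFactor, ← Complex.exp_nat_mul]
    congr 1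
    push_cast
    ring
  · simp

/-- Phase estimation with the convolution window has an exponentially small tail. -/
theorem sum_phaseProb_windowAmp_le (m : ℕ) {L : ℕ} (hL : 0 < L) (θ : ℝ) {μ : ℝ} (hμ : 0 < μ) :
    ∑ y : Fin (windowDeg m L + 1),
      (if μ ≤ |Real.sin (θ - Real.pi * (y : ℕ) / (windowDeg m L + 1 : ℕ))| then
        phaseProb (windowAmp m L) θ y else 0) ≤ (m + 1) * (1 / (μ * L)) ^ (2 * m) := by
  set P : ℕ := windowDeg m L + 1 with hP
  have hL0 : (0 : ℝ) < L := by exact_mod_cast hL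
  -- Of the $2(m+1)$ kernel factors, $2m$ are bounded by $1/\mu$; the other two are kept for
  -- Parseval.
  have hterm : ∀ y : Fin P, (if μ ≤ |Real.sin (θ - Real.pi * (y : ℕ) / (P : ℕ))| then
      phaseProb (windowAmp m L) θ y else 0) ≤ 1 / (L : ℝ) ^ (2 * (m + 1)) * (1 / μ) ^ (2 * m) *
        ‖∑ i ∈ Finset.range L, phaseFactor (windowDeg m L) θ y ^ i‖ ^ 2 := by
    intro y
    split_ifs with h
    · rw [phaseProb_windowAmp m hL]
      set B := ‖∑ i ∈ Finset.range L, phaseFactor (windowDeg m L) θ y ^ i‖ with hB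
      have hB0 : 0 ≤ B := norm_nonneg _
      have h1 : B ≤ 1 / μ := by
        rw [le_div_iff₀ hμ]
        exact (mul_le_mul_of_nonneg_left h hB0).trans
          (norm_geom_sum_phaseFactor_mul_le (windowDeg m L) L θ y)
      have h2 : B ^ (2 * (m + 1)) = B ^ (2 * m) * B ^ 2 := by ring
      rw [h2, ← mul_assoc]
      gcongr
      exact le_windowNormSq m L
    · positivity
  refine (Finset.sum_le_sum fun y _ => hterm y).trans ?_
  have hLP : L ≤ windowDeg m L + 1 := by
    have : L - 1 ≤ (m + 1) * (L - 1) := Nat.le_mul_of_pos_left _ (Nat.succ_pos m)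
    simp only [windowDeg]
    omega
  have hPL : ((windowDeg m L + 1 : ℕ) : ℝ) ≤ (m + 1) * L := by
    have h1 : windowDeg m L + 1 ≤ (m + 1) * L := by
      obtain ⟨l, rfl⟩ : ∃ l, L = l + 1 := ⟨L - 1, by omega⟩
      simp only [windowDeg, Nat.add_sub_cancel]
      nlinarith
    exact_mod_cast h1
  rw [← Finset.mul_sum, sum_norm_sq_geom_sum_phaseFactor _ _ hLP]
  calc _ ≤ 1 / (L : ℝ) ^ (2 * (m + 1)) * (1 / μ) ^ (2 * m) * ((m + 1) * L * L) := by gcongr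
    _ = _ := by
      rw [one_div_mul_eq_div, one_div_pow, one_div_pow, mul_pow]
      field_simp
      ring

end Window

/-! ### The additive and multiplicative estimators -/

section Estimators

variable {N T : ℕ}

/-- The weight `g` dominates the indicator of failure. It may be chosen to depend on the phase
register alone, whose law is known. -/
theorem prob_run_ret [NeZero N] {w : ℕ} {α : Type} (O : OracleTable N T) (C : Circuit N T w)
    (f : Basis N T w → α) (E : Set α) {δ : ℝ} (g : Basis N T w → ℝ)
    (hg : ∀ b, 0 ≤ g b) (hE : ∀ b, f b ∉ E → 1 ≤ g b)
    (hδ : ∑ b, g b * ‖C.state O C.queries b‖ ^ 2 ≤ δ) :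
    ENNReal.ofReal (1 - δ) ≤ (QAlg.run C fun b => .ret (f b)).prob O E := by
  classical
  have h1 : (QAlg.run C fun b => .ret (f b)).output O = (C.measure O).map f := rfl
  rw [QAlg.prob, h1, PMF.toOuterMeasure_map_apply, PMF.toOuterMeasure_apply_fintype]
  have h2 : ∀ b, (f ⁻¹' E).indicator (C.measure O) b =
      ENNReal.ofReal (if f b ∈ E then ‖C.state O C.queries b‖ ^ 2 else 0) := fun b => by
    by_cases hb : f b ∈ E
    · simp [hb, Circuit.measure]
    · simp [hb]
  simp_rw [h2]
  rw [← ENNReal.ofReal_sum_of_nonneg fun b _ => by split_ifs <;> positivity]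
  refine ENNReal.ofReal_le_ofReal ?_
  have h3 := C.sum_sq_state O C.queries
  have h4 : ∑ b, ‖C.state O C.queries b‖ ^ 2 ≤
      ∑ b, (if f b ∈ E then ‖C.state O C.queries b‖ ^ 2 else 0) +
        ∑ b, g b * ‖C.state O C.queries b‖ ^ 2 := by
    rw [← Finset.sum_add_distrib]
    refine Finset.sum_le_sum fun b _ => ?_
    split_ifs with hb
    · have := mul_nonneg (hg b) (sq_nonneg ‖C.state O C.queries b‖)
      linarith
    · have := mul_le_mul_of_nonneg_right (hE b hb) (sq_nonneg ‖C.state O C.queries b‖)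
      linarith
  linarith

/-- A circuit that makes `q` queries on `S` whose results are not used. -/
def idleCircuit (N T : ℕ) [NeZero N] [NeZero T] (S : Finset (Fin N)) (q : ℕ) : Circuit N T 1 where
  start := (S, 0, 0, 0)
  queries := q
  gate _ := 1

theorem idleCircuit_queriesOn [NeZero N] [NeZero T] (S : Finset (Fin N)) (q : ℕ) :
    (idleCircuit N T S q).QueriesOn S := by
  intro O k _
  induction k with
  | zero =>
    intro b hb
    have : b ≠ (S, 0, 0, 0) := fun h => hb (by rw [h])
    simp [Circuit.state, idleCircuit, this]
  | succ k ih =>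
    intro b hb
    have := ih (by omega) ((oraclePerm 1 O).symm b) hb
    simpa [Circuit.state, idleCircuit, applyOracle] using this

theorem markedFraction_nonneg (O : OracleTable N T) (S R : Finset (Fin N)) :
    0 ≤ markedFraction O S R := by
  unfold markedFraction
  positivity

theorem markedFraction_le_one (O : OracleTable N T) (S R : Finset (Fin N)) :
    markedFraction O S R ≤ 1 := by
  refine div_le_one_of_le₀ ?_ (Nat.cast_nonneg T)
  have := Finset.card_le_univ (Finset.univ.filter fun t => O S t ∈ R)
  rw [Fintype.card_fin] at this
  exact_mod_cast this

theorem Represents.weight_condDist {O : OracleTable N T} {D : Fin N → ℝ} (h : Represents O D)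
    {S : Finset (Fin N)} (hS : 0 < weight D S) (R : Finset (Fin N)) :
    weight (condDist D S) R = markedFraction O S R := by
  classical
  rw [weight, markedFraction, Finset.sum_congr rfl fun i _ => h S hS i, ← Finset.sum_div]
  congr 1
  rw [Finset.card_eq_sum_card_fiberwise (f := O S) (t := R) (fun t ht => by simpa using ht)]
  push_cast
  refine Finset.sum_congr rfl fun i hi => ?_
  congr 2
  ext t
  simp only [Finset.mem_filter, Finset.mem_univ, true_and]
  exact ⟨fun h => ⟨h ▸ hi, h⟩, fun h => h.2⟩

/-- The estimate of the weight computed from the outcome `y` of phase estimation. -/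
def phaseEstimate {J : ℕ} (y : Fin (J + 1)) : ℝ := Real.sin (Real.pi * (y : ℕ) / (J + 1 : ℕ)) ^ 2

/-- The difference of squares factors as $-\sin(\theta-x)\sin(\theta+x)$, and
$\theta+x=2\theta-(\theta-x)$ bounds the second factor. -/
theorem abs_sin_sq_sub_sin_sq_le {x θ μ : ℝ} (h : |Real.sin (θ - x)| ≤ μ) :
    |Real.sin x ^ 2 - Real.sin θ ^ 2| ≤ μ * (μ + 2 * |Real.sin θ|) := by
  have h1 : Real.sin x ^ 2 - Real.sin θ ^ 2 = -(Real.sin (θ - x) * Real.sin (θ + x)) := by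
    rw [Real.sin_sub, Real.sin_add]
    have h2 := Real.sin_sq_add_cos_sq x
    have h3 := Real.sin_sq_add_cos_sq θ
    linear_combination Real.sin θ ^ 2 * h2 - Real.sin x ^ 2 * h3
  have h2 : |Real.sin (θ + x)| ≤ μ + 2 * |Real.sin θ| := by
    have h3 : θ + x = 2 * θ - (θ - x) := by ring
    rw [h3, Real.sin_sub, Real.sin_two_mul]
    refine (abs_sub _ _).trans ?_
    rw [abs_mul, abs_mul, abs_mul, abs_mul, abs_two]
    have h4 : |Real.cos θ| * |Real.cos (θ - x)| ≤ 1 :=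
      mul_le_one₀ (Real.abs_cos_le_one _) (abs_nonneg _) (Real.abs_cos_le_one _)
    have h5 : |Real.cos (2 * θ)| * |Real.sin (θ - x)| ≤ μ :=
      (mul_le_of_le_one_left (abs_nonneg _) (Real.abs_cos_le_one _)).trans h
    have h6 : 2 * |Real.sin θ| * |Real.cos θ| * |Real.cos (θ - x)| ≤ 2 * |Real.sin θ| := by
      rw [mul_assoc]
      exact mul_le_of_le_one_right (by positivity) h4
    linarith
  rw [h1, abs_neg, abs_mul]
  exact mul_le_mul h h2 (abs_nonneg _) ((abs_nonneg _).trans h)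

/-- The error of amplitude estimation. -/
theorem le_prob_estCircuit [NeZero N] [NeZero T] (O : OracleTable N T) (S R : Finset (Fin N))
    (m : ℕ) {L : ℕ} (hL : 0 < L) {μ ε : ℝ} (hμ : 0 < μ)
    (hε : μ * (μ + 2 * √(markedFraction O S R)) ≤ ε) :
    ENNReal.ofReal (1 - (m + 1) * (1 / (μ * L)) ^ (2 * m)) ≤
      (QAlg.run (estCircuit N T S R (windowAmp m L)) fun b =>
        .ret (phaseEstimate b.2.2.2)).prob O {v | |v - markedFraction O S R| ≤ ε} := by
  classical
  have hα := sum_windowAmp_sq m hL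
  set p := markedFraction O S R with hp
  have hp0 : 0 ≤ p := markedFraction_nonneg O S R
  have hp1 : p ≤ 1 := markedFraction_le_one O S R
  have hsin : Real.sin (Real.arcsin √p) = √p :=
    Real.sin_arcsin (by linarith [Real.sqrt_nonneg p]) (Real.sqrt_le_one.mpr hp1)
  set θ := Real.arcsin √p
  have hθ : Real.sin θ ^ 2 = p := by rw [hsin, Real.sq_sqrt hp0]
  have habs : |Real.sin θ| = √p := by rw [hsin, abs_of_nonneg (Real.sqrt_nonneg p)]
  let g : Fin (windowDeg m L + 1) → ℝ := fun y => if |phaseEstimate y - p| ≤ ε then 0 else 1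
  refine prob_run_ret O _ _ _ (fun b => g b.2.2.2) (fun b => ?_) (fun b hb => ?_) ?_
  · simp only [g]
    split_ifs <;> norm_num
  · have hb' : ¬ |phaseEstimate b.2.2.2 - p| ≤ ε := hb
    simp only [g, hb', if_false, le_refl]
  have h := sum_norm_sq_estCircuit_state O S R hα hθ g
  refine h.trans_le ?_
  have h1 := sum_phaseProb_windowAmp_le m hL θ hμ
  have h2 := sum_phaseProb_windowAmp_le m hL (-θ) hμ
  have hnn : ∀ (φ : ℝ) y, 0 ≤ phaseProb (windowAmp m L) φ y := fun φ y => by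
    unfold phaseProb
    positivity
  -- A wrong estimate forces `y` into the tail. Only $\sin^2\varphi$ and $|\sin\varphi|$ enter, so
  -- the same argument serves $\theta$ and $-\theta$.
  have hbad : ∀ (φ : ℝ) (y : Fin (windowDeg m L + 1)), Real.sin φ ^ 2 = p → |Real.sin φ| = √p →
      g y * phaseProb (windowAmp m L) φ y ≤
      if μ ≤ |Real.sin (φ - Real.pi * (y : ℕ) / (windowDeg m L + 1 : ℕ))| then
        phaseProb (windowAmp m L) φ y else 0 := by
    intro φ y hφ hφ'
    simp only [g]
    split_ifs with h3 h4 h4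
    · simpa using hnn φ y
    · simp
    · simp
    · refine absurd ?_ h3
      have := abs_sin_sq_sub_sin_sq_le (not_le.mp h4).le
      rw [hφ, hφ'] at this
      exact this.trans hε
  calc _ = (∑ y, g y * phaseProb (windowAmp m L) θ y +
        ∑ y, g y * phaseProb (windowAmp m L) (-θ) y) / 2 := by
        rw [← Finset.sum_add_distrib, Finset.sum_div]
        exact Finset.sum_congr rfl fun y _ => by ring
    _ ≤ _ := by
        have h3 := Finset.sum_le_sum fun y (_ : y ∈ Finset.univ) => hbad θ y hθ habs
        have h4 := Finset.sum_le_sum fun y (_ : y ∈ Finset.univ) => hbad (-θ) y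
          (by rw [Real.sin_neg, neg_sq, hθ]) (by rw [Real.sin_neg, abs_neg, habs])
        linarith

/-- The exponent of the window used for failure probability `δ`. -/
def windowOrder (δ : ℝ) : ℕ := ⌈Real.log (1 / min δ (1 / 2))⌉₊

/-- The box length of the window used for `M` queries and failure probability `δ`. -/
def windowLength (M : ℕ) (δ : ℝ) : ℕ := M / (2 * (windowOrder δ + 1)) + 1

/-- The `+ 1` in `windowLength` keeps the box nonempty and costs no query, since the degree involves
$L-1$. Idle queries fill the gap up to `M`. -/
theorem two_mul_windowDeg_le (M : ℕ) (δ : ℝ) :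
    2 * windowDeg (windowOrder δ) (windowLength M δ) ≤ M := by
  rw [windowDeg, windowLength, Nat.add_sub_cancel, ← mul_assoc]
  exact Nat.mul_div_le M _

theorem half_lt_log_inv {δ : ℝ} (h0 : 0 < δ) : 1 / 2 < Real.log (1 / min δ (1 / 2)) := by
  have h1 : 0 < min δ (1 / 2) := lt_min h0 (by norm_num)
  have h2 : Real.log 2 ≤ Real.log (1 / min δ (1 / 2)) := by
    refine Real.log_le_log (by norm_num) ?_
    rw [le_div_iff₀ h1]
    linarith [min_le_right δ (1 / 2)]
  linarith [Real.log_two_gt_d9]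

/-- As $m+1\le2^m$, the left side is at most $8^{-m}\le e^{-m}$, and $m\ge\ell(\delta)$. -/
theorem windowOrder_tail_le {δ : ℝ} (h0 : 0 < δ) :
    ((windowOrder δ : ℝ) + 1) * (1 / 4) ^ (2 * windowOrder δ) ≤ δ := by
  set m := windowOrder δ with hm
  have h1 : 0 < min δ (1 / 2) := lt_min h0 (by norm_num)
  have h2 : ((m : ℝ) + 1) ≤ 2 ^ m := by
    have : m + 1 ≤ 2 ^ m := Nat.lt_two_pow_self
    exact_mod_cast this
  have h3 : Real.log (1 / min δ (1 / 2)) ≤ m := Nat.le_ceil _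
  have h4 : 1 / min δ (1 / 2) ≤ 8 ^ m := by
    rw [← Real.exp_log (show 0 < 1 / min δ (1 / 2) by positivity)]
    calc _ ≤ Real.exp m := Real.exp_le_exp.mpr h3
      _ = Real.exp 1 ^ m := by rw [← Real.exp_nat_mul, mul_one]
      _ ≤ 8 ^ m := by
        gcongr
        linarith [Real.exp_one_lt_d9]
  calc ((m : ℝ) + 1) * (1 / 4) ^ (2 * m) ≤ 2 ^ m * (1 / 4) ^ (2 * m) := by gcongr
    _ = 1 / 8 ^ m := by
      rw [pow_mul, ← mul_pow, ← one_div_pow]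
      norm_num
    _ ≤ 1 / (1 / min δ (1 / 2)) := one_div_le_one_div_of_le (by positivity) h4
    _ ≤ δ := by
      rw [one_div_one_div]
      exact min_le_left _ _

/-- Here $1/L<2(m+1)/M$ and $m<\ell+1$, so the left side is below $8(\ell+2)/M$; the cap on $\delta$
gives $\ell>1/2$, hence $\ell+2<5\ell$. -/
theorem four_div_windowLength_le {M : ℕ} (hM : 0 < M) {δ : ℝ} (h0 : 0 < δ) :
    4 / (windowLength M δ : ℝ) ≤ 40 * Real.log (1 / min δ (1 / 2)) / M := by
  have h1 := half_lt_log_inv h0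
  set l := Real.log (1 / min δ (1 / 2)) with hl
  have h2 : (windowOrder δ : ℝ) < l + 1 := Nat.ceil_lt_add_one (by linarith)
  have hM' : (0 : ℝ) < M := by exact_mod_cast hM
  have h3 : M < 2 * (windowOrder δ + 1) * windowLength M δ :=
    Nat.lt_mul_div_succ M (by positivity)
  have h4 : (M : ℝ) < 2 * (windowOrder δ + 1) * windowLength M δ := by exact_mod_cast h3
  have h5 : (0 : ℝ) < windowLength M δ := by
    rw [windowLength]
    positivity
  rw [div_le_div_iff₀ h5 hM']
  nlinarith

/-- Additive estimation of `D_S(R)` with `M` queries on the set `S`. -/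
def addEstProbQCond : Estimator := fun N T S R M δ =>
  open Classical in
  if h : NeZero N ∧ NeZero T then
    haveI := h.1
    haveI := h.2
    .run (idleCircuit N T S (M - 2 * windowDeg (windowOrder δ) (windowLength M δ))) fun _ =>
      .run (estCircuit N T S R (windowAmp (windowOrder δ) (windowLength M δ))) fun b =>
        .ret (phaseEstimate b.2.2.2)
  else .ret 0

theorem addEstProbQCond_eq [NeZero N] [NeZero T] (S R : Finset (Fin N)) (M : ℕ) (δ : ℝ) :
    addEstProbQCond N T S R M δ =
    .run (idleCircuit N T S (M - 2 * windowDeg (windowOrder δ) (windowLength M δ))) fun _ =>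
      .run (estCircuit N T S R (windowAmp (windowOrder δ) (windowLength M δ))) fun b =>
        .ret (phaseEstimate b.2.2.2) :=
  dif_pos ⟨inferInstance, inferInstance⟩

theorem isAddEstProbQCond_addEstProbQCond : IsAddEstProbQCond 160 addEstProbQCond := by
  intro N T _ _ S R M δ _ h0 _
  have hLpos : 0 < windowLength M δ := Nat.succ_pos _
  rw [addEstProbQCond_eq]
  refine ⟨⟨idleCircuit_queriesOn S _, 2 * windowDeg (windowOrder δ) (windowLength M δ),
    (Nat.sub_add_cancel (two_mul_windowDeg_le M δ)).symm,
    fun _ => ⟨estCircuit_queriesOn S R (sum_windowAmp_sq _ hLpos), 0, rfl, fun _ => rfl⟩⟩, ?_⟩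
  intro D _ O hO hS ε hε hM
  rw [hO.weight_condDist hS] at hM ⊢
  set p := markedFraction O S R with hp
  have hl := half_lt_log_inv h0
  set l := Real.log (1 / min δ (1 / 2)) with hldef
  have hsε : 0 < √ε := Real.sqrt_pos.mpr hε
  have hL : (0 : ℝ) < windowLength M δ := by exact_mod_cast hLpos
  have hM1 : 160 * l * (1 / √ε) ≤ M := (by gcongr; exact le_max_right _ _ :
    160 * l * (1 / √ε) ≤ 160 * l * max (√p / ε) (1 / √ε)).trans hM
  have hM2 : 160 * l * (√p / ε) ≤ M := (by gcongr; exact le_max_left _ _ :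
    160 * l * (√p / ε) ≤ 160 * l * max (√p / ε) (1 / √ε)).trans hM
  have hMpos : (0 : ℝ) < M := lt_of_lt_of_le (by positivity) hM1
  have hμ := four_div_windowLength_le (by exact_mod_cast hMpos : 0 < M) h0
  rw [← hldef] at hμ
  set μ : ℝ := 4 / windowLength M δ with hμdef
  have hμpos : 0 < μ := by positivity
  have hμ1 : μ ≤ √ε / 4 := by
    refine hμ.trans ?_
    rw [div_le_iff₀ hMpos]
    rw [mul_one_div, div_le_iff₀ hsε] at hM1
    linarith
  have hμ2 : μ * √p ≤ ε / 4 := by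
    refine (mul_le_mul_of_nonneg_right hμ (Real.sqrt_nonneg p)).trans ?_
    rw [div_mul_eq_mul_div, div_le_iff₀ hMpos]
    rw [← mul_div_assoc, div_le_iff₀ hε] at hM2
    linarith
  -- The constant 160 is $4\cdot40$: it makes $\mu\le\sqrt\epsilon/4$ and $\mu\sqrt p\le\epsilon/4$,
  -- so the error is at most $\epsilon/16+\epsilon/2$.
  have hacc : μ * (μ + 2 * √p) ≤ ε := by
    have h1 : μ * μ ≤ (√ε / 4) * (√ε / 4) := mul_le_mul hμ1 hμ1 hμpos.le (by positivity)
    have h2 := Real.mul_self_sqrt hε.le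
    nlinarith
  have key := le_prob_estCircuit O S R (windowOrder δ) hLpos hμpos hacc
  have hout : ∀ (C : Circuit N T 1) (A : QAlg N T ℝ) (E : Set ℝ),
      (QAlg.run C fun _ => A).prob O E = A.prob O E := fun C A E => by
    simp [QAlg.prob, QAlg.output, PMF.bind_const]
  rw [hout]
  refine le_trans (ENNReal.ofReal_le_ofReal ?_) key
  have h1 : 1 / (μ * windowLength M δ) = 1 / 4 := by
    rw [hμdef, div_mul_cancel₀ _ hL.ne']
  rw [h1]
  linarith [windowOrder_tail_le h0]

/-- Multiplicative estimation of `D_S(R)` with `M` queries on the set `S`. A nonpositive estimate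
is replaced by `1 / T`, which is at most `D_S(R)` unless the latter vanishes. -/
def mulEstProbQCond : Estimator := fun N T S R M δ =>
  (addEstProbQCond N T S R M δ).bind fun v => .ret (if 0 < v then v else 1 / T)

theorem one_div_le_markedFraction {O : OracleTable N T} {S R : Finset (Fin N)}
    (h : 0 < markedFraction O S R) : 1 / (T : ℝ) ≤ markedFraction O S R := by
  unfold markedFraction at h ⊢
  have hT : (0 : ℝ) ≤ T := Nat.cast_nonneg T
  have h1 : (0 : ℝ) < ((Finset.univ.filter fun t => O S t ∈ R).card : ℝ) :=
    pos_of_mul_pos_left (by rwa [div_eq_mul_inv] at h) (inv_nonneg.mpr hT)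
  have h2 : 1 ≤ (Finset.univ.filter fun t => O S t ∈ R).card := by exact_mod_cast h1
  gcongr
  exact_mod_cast h2

theorem isMulEstProbQCond_mulEstProbQCond : IsMulEstProbQCond 160 mulEstProbQCond := by
  intro N T _ _ S R M δ hRS h0 h1
  obtain ⟨hq, hacc⟩ := isAddEstProbQCond_addEstProbQCond N T S R M δ hRS h0 h1
  refine ⟨hq.bind (r := 0) fun _ => rfl, ?_⟩
  intro D hD O hO hS hp ε hε hε1 hM
  have hpT : 1 / (T : ℝ) ≤ weight (condDist D S) R := by
    rw [hO.weight_condDist hS] at hp ⊢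
    exact one_div_le_markedFraction hp
  set p := weight (condDist D S) R with hpdef
  have hsp : 0 < √p := Real.sqrt_pos.mpr hp
  have hpp := Real.mul_self_sqrt hp.le
  -- For additive error $\epsilon p$ the first term equals the multiplicative cost, and the second
  -- is no larger because $\epsilon\le1$.
  have h2 : max (√p / (ε * p)) (1 / √(ε * p)) ≤ 1 / (ε * √p) := by
    refine max_le (le_of_eq ?_) (one_div_le_one_div_of_le (by positivity) ?_)
    · rw [div_eq_div_iff (by positivity) (by positivity)]
      linear_combination ε * hpp
    · rw [Real.sqrt_mul hε.le]
      gcongr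
      exact Real.le_sqrt_of_sq_le (by nlinarith)
  have hl := half_lt_log_inv h0
  have h3 := hacc D hD O hO hS (ε * p) (by positivity) (le_trans (by
    rw [div_eq_mul_one_div (160 * Real.log (1 / min δ (1 / 2)))]
    gcongr) hM)
  have h4 := QAlg.le_prob_bind (b := 0) h0.le le_rfl h3
    (f := fun v => .ret (if 0 < v then v else 1 / (T : ℝ)))
    (F := {v | v ∈ Set.Icc ((1 - ε) * p) ((1 + ε) * p)}) (fun v hv => by
      rw [QAlg.prob_ret]
      · simp
      · have hv' : -(ε * p) ≤ v - p ∧ v - p ≤ ε * p := abs_le.mp hv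
        simp only [Set.mem_ofPred_eq, Set.mem_Icc]
        split_ifs with h
        · constructor <;> nlinarith
        -- A nonpositive `v` in range gives $(1-\epsilon)p\le0$, so the replacement $1/T\in[0,p]$
        -- lies in the interval.
        · push Not at h
          have hT : 0 ≤ 1 / (T : ℝ) := by positivity
          constructor <;> nlinarith)
  rwa [add_zero] at h4

theorem pos_of_mem_support_mulEstProbQCond [NeZero N] [NeZero T] {O : OracleTable N T}
    {S R : Finset (Fin N)} {M : ℕ} {δ v : ℝ}
    (hv : v ∈ ((mulEstProbQCond N T S R M δ).output O).support) : 0 < v := by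
  have hT : (0 : ℝ) < T := by exact_mod_cast NeZero.pos T
  rw [mulEstProbQCond, QAlg.output_bind, PMF.mem_support_bind_iff] at hv
  obtain ⟨u, _, hu⟩ := hv
  simp only [QAlg.output, PMF.support_pure, Set.mem_singleton_iff] at hu
  rw [hu]
  split_ifs with h
  · exact h
  · positivity

end Estimators

/-! ### Ratios, thresholds and the query budget -/

section Compare

variable {N T : ℕ}

theorem weight_nonneg {D : Fin N → ℝ} (hD : D ∈ stdSimplex ℝ (Fin N)) (S : Finset (Fin N)) :
    0 ≤ weight D S :=
  Finset.sum_nonneg fun i _ => hD.1 i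

theorem weight_union (D : Fin N → ℝ) {X Y : Finset (Fin N)} (h : Disjoint X Y) :
    weight D (X ∪ Y) = weight D X + weight D Y :=
  Finset.sum_union h

theorem weight_condDist_of_subset (D : Fin N → ℝ) {R S : Finset (Fin N)} (h : R ⊆ S) :
    weight (condDist D S) R = weight D R / weight D S := by
  rw [weight, weight, Finset.sum_div]
  exact Finset.sum_congr rfl fun i hi => if_pos (h hi)

theorem ratio_eq_ofReal {D : Fin N → ℝ} {X Y : Finset (Fin N)} (hX : 0 < weight D X) :
    ratio D X Y = ENNReal.ofReal (weight D Y / weight D X) :=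
  (ENNReal.ofReal_div_of_pos hX).symm

theorem ratio_eq_top {D : Fin N → ℝ} {X Y : Finset (Fin N)} (hX : weight D X = 0)
    (hY : 0 < weight D Y) : ratio D X Y = ∞ := by
  rw [ratio, hX, ENNReal.ofReal_zero, ENNReal.div_zero]
  exact (ENNReal.ofReal_pos.mpr hY).ne'

/-- Clearing the denominator stays valid for $D(X)=0$: then $D(Y)>0$, the ratio is $\infty$, and
both sides fail. -/
theorem ratio_le_ofReal_iff {D : Fin N → ℝ} {X Y : Finset (Fin N)} (hX : 0 ≤ weight D X)
    (hXY : 0 < weight D X + weight D Y) {k : ℝ} (hk : 0 ≤ k) :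
    ratio D X Y ≤ ENNReal.ofReal k ↔ weight D Y ≤ k * weight D X := by
  rcases hX.eq_or_lt with h | h
  · have hY : 0 < weight D Y := by linarith
    rw [ratio_eq_top h.symm hY, ← h, mul_zero]
    simpa using hY
  · rw [ratio_eq_ofReal h, ENNReal.ofReal_le_ofReal_iff hk, div_le_iff₀ h]

theorem ofReal_le_ratio_iff {D : Fin N → ℝ} {X Y : Finset (Fin N)} (hX : 0 ≤ weight D X)
    (hY : 0 ≤ weight D Y) (hXY : 0 < weight D X + weight D Y) {k : ℝ} :
    ENNReal.ofReal k ≤ ratio D X Y ↔ k * weight D X ≤ weight D Y := by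
  rcases hX.eq_or_lt with h | h
  · have hY : 0 < weight D Y := by linarith
    rw [ratio_eq_top h.symm hY, ← h, mul_zero]
    simpa using hY.le
  · rw [ratio_eq_ofReal h, ENNReal.ofReal_le_ofReal_iff (div_nonneg hY hX), le_div_iff₀ h]

/-- For $\eta<1$ one has $1+\eta/3\le(1+\eta)(1-\eta/3)$ and $(1-\eta)(1+\eta/3)\le1-\eta/3$, so
relative errors $\eta/3$ combine to at most $\eta$. -/
theorem value_div_mem_goodValues {D : Fin N → ℝ} {X Y : Finset (Fin N)} {η W u v : ℝ}
    (hη : 0 < η) (hη1 : η < 1) (hW : 0 < W) (hX : 0 < weight D X) (hY : 0 < weight D Y)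
    (hu : u ∈ Set.Icc ((1 - η / 3) * (weight D X / W)) ((1 + η / 3) * (weight D X / W)))
    (hv : v ∈ Set.Icc ((1 - η / 3) * (weight D Y / W)) ((1 + η / 3) * (weight D Y / W))) :
    CompareOutput.value (v / u) ∈ goodValues η (ratio D X Y) := by
  obtain ⟨hu1, hu2⟩ := hu
  obtain ⟨hv1, hv2⟩ := hv
  have hx : 0 < weight D X / W := div_pos hX hW
  have hy : 0 < weight D Y / W := div_pos hY hW
  have hr : weight D Y / weight D X = (weight D Y / W) / (weight D X / W) :=
    (div_div_div_cancel_right₀ hW.ne' _ _).symm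
  set x := weight D X / W
  set y := weight D Y / W
  have hu0 : 0 < u := lt_of_lt_of_le (by nlinarith) hu1
  have hv0 : 0 < v := lt_of_lt_of_le (by nlinarith) hv1
  have hxy : 0 < x * y := mul_pos hx hy
  refine ⟨v / u, div_pos hv0 hu0, rfl, ?_⟩
  rw [ratio_eq_ofReal hX, hr, ← ENNReal.ofReal_mul (by linarith), ← ENNReal.ofReal_mul (by linarith)]
  constructor
  · refine ENNReal.ofReal_le_ofReal ?_
    rw [← mul_div_assoc, div_le_div_iff₀ hx hu0]
    calc (1 - η) * y * u ≤ (1 - η) * y * ((1 + η / 3) * x) :=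
          mul_le_mul_of_nonneg_left hu2 (mul_nonneg (by linarith) hy.le)
      _ = ((1 - η) * (1 + η / 3)) * (x * y) := by ring
      _ ≤ (1 - η / 3) * (x * y) := mul_le_mul_of_nonneg_right (by nlinarith) hxy.le
      _ = (1 - η / 3) * y * x := by ring
      _ ≤ v * x := mul_le_mul_of_nonneg_right hv1 hx.le
  · refine ENNReal.ofReal_le_ofReal ?_
    rw [← mul_div_assoc, div_le_div_iff₀ hu0 hx]
    calc v * x ≤ (1 + η / 3) * y * x := mul_le_mul_of_nonneg_right hv2 hx.le
      _ = (1 + η / 3) * (x * y) := by ring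
      _ ≤ ((1 + η) * (1 - η / 3)) * (x * y) := mul_le_mul_of_nonneg_right (by nlinarith) hxy.le
      _ = (1 + η) * y * ((1 - η / 3) * x) := by ring
      _ ≤ (1 + η) * y * u := mul_le_mul_of_nonneg_left hu1 (mul_nonneg (by linarith) hy.le)

/-- An estimate of a weight that is at most `K / (K + 1)` stays below the threshold. -/
theorem estimate_le_threshold {K η q a : ℝ} (hK : 1 ≤ K) (hη : η < 3 / (8 * K)) (hη0 : 0 < η)
    (hq : q ≤ K / (K + 1)) (ha : |a - q| ≤ η / 4) : a ≤ 3 * K / (3 * K + 1) - η / 3 := by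
  have h1 := (abs_le.mp ha).2
  -- This reduces to $(K-1)(5K+1)\ge0$. The gap $1/(4K)$ absorbs $\eta/4+\eta/3=7\eta/12<7/(32K)$.
  have h2 : K / (K + 1) + 1 / (4 * K) ≤ 3 * K / (3 * K + 1) := by
    rw [div_add_div _ _ (by positivity) (by positivity), div_le_div_iff₀ (by positivity)
      (by positivity)]
    nlinarith [mul_nonneg (sub_nonneg.mpr hK) (sub_nonneg.mpr hK),
      mul_nonneg (sub_nonneg.mpr hK) (mul_nonneg (sub_nonneg.mpr hK) (sub_nonneg.mpr hK))]
  have h3 : 3 / (8 * K) = 3 / 2 * (1 / (4 * K)) := by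
    field_simp
    norm_num
  linarith

/-- An estimate of a weight that exceeds `3K / (3K + 1)` exceeds the threshold. -/
theorem threshold_lt_estimate {K η q a : ℝ} (hη0 : 0 < η) (hq : 3 * K / (3 * K + 1) < q)
    (ha : |a - q| ≤ η / 4) : ¬ a ≤ 3 * K / (3 * K + 1) - η / 3 := by
  have h1 := (abs_le.mp ha).1
  intro h
  linarith

theorem makesQueries_qCompare [NeZero N] {addEst mulEst : Estimator} {c : ℝ}
    (hadd : IsAddEstProbQCond c addEst) (hmul : IsMulEstProbQCond c mulEst) [NeZero T] (M : ℕ)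
    (X Y : Finset (Fin N)) (η K : ℝ) {δ : ℝ} (h0 : 0 < δ) (h1 : δ ≤ 1) :
    (qCompare addEst mulEst M N T X Y η K δ).MakesQueries (X ∪ Y) (4 * M) := by
  have hX := @Finset.subset_union_left _ _ X Y
  have hY := @Finset.subset_union_right _ _ X Y
  have h0' : 0 < δ / 4 := by linarith
  have h1' : δ / 4 ≤ 1 := by linarith
  have h4 : 4 * M = M + (M + (M + (M + 0))) := by ring
  rw [h4]
  exact (hadd N T _ X M _ hX h0' h1').1.bind fun _ => (hadd N T _ Y M _ hY h0' h1').1.bind fun _ =>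
    (hmul N T _ X M _ hX h0' h1').1.bind fun _ => (hmul N T _ Y M _ hY h0' h1').1.bind fun _ => rfl

/-- The union bound over the four estimations of `qCompare`. -/
theorem le_prob_qCompare [NeZero N] {addEst mulEst : Estimator} {O : OracleTable N T} {M : ℕ}
    {X Y : Finset (Fin N)} {η K δ : ℝ} (h0 : 0 ≤ δ) {E₁ E₂ E₃ E₄ : Set ℝ} {F : Set CompareOutput}
    (h₁ : ENNReal.ofReal (1 - δ / 4) ≤ (addEst N T (X ∪ Y) X M (δ / 4)).prob O E₁)
    (h₂ : ENNReal.ofReal (1 - δ / 4) ≤ (addEst N T (X ∪ Y) Y M (δ / 4)).prob O E₂)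
    (h₃ : ENNReal.ofReal (1 - δ / 4) ≤ (mulEst N T (X ∪ Y) X M (δ / 4)).prob O E₃)
    (h₄ : ENNReal.ofReal (1 - δ / 4) ≤ (mulEst N T (X ∪ Y) Y M (δ / 4)).prob O E₄)
    (hF : ∀ a ∈ E₁, ∀ b ∈ E₂, ∀ u ∈ E₃, ∀ v ∈ E₄,
      (if ¬ a ≤ 3 * K / (3 * K + 1) - η / 3 then CompareOutput.low
      else if ¬ b ≤ 3 * K / (3 * K + 1) - η / 3 then .high else .value (v / u)) ∈ F) :
    ENNReal.ofReal (1 - δ) ≤ (qCompare addEst mulEst M N T X Y η K δ).prob O F := by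
  have hδ : 0 ≤ δ / 4 := by linarith
  have h : δ = δ / 4 + (δ / 4 + (δ / 4 + (δ / 4 + 0))) := by ring
  conv_lhs => rw [h]
  exact QAlg.le_prob_bind hδ (by positivity) h₁ fun a ha =>
    QAlg.le_prob_bind hδ (by positivity) h₂ fun b hb =>
    QAlg.le_prob_bind hδ (by positivity) h₃ fun u hu =>
    QAlg.le_prob_bind hδ le_rfl h₄ fun v hv => by
      rw [QAlg.prob_ret O (hF a ha b hb u hu v hv)]
      simp

/-- Positivity must hold for every possible output, not just with high probability; this is why a
vanishing estimate is replaced by $1/T$. -/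
theorem pos_of_value_mem_support_qCompare [NeZero N] {addEst mulEst : Estimator}
    {O : OracleTable N T} {M : ℕ} {X Y : Finset (Fin N)} {η K δ v : ℝ}
    (hpos : ∀ R v, v ∈ ((mulEst N T (X ∪ Y) R M (δ / 4)).output O).support → 0 < v)
    (hv : CompareOutput.value v ∈
      ((qCompare addEst mulEst M N T X Y η K δ).output O).support) : 0 < v := by
  simp only [qCompare, QAlg.output_bind, PMF.mem_support_bind_iff, QAlg.output, PMF.support_pure,
    Set.mem_singleton_iff] at hv
  obtain ⟨a, _, b, _, u, hu, w, hw, h⟩ := hv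
  split_ifs at h
  rw [CompareOutput.value.inj h]
  exact div_pos (hpos _ _ hw) (hpos _ _ hu)

/-- The number of queries that `qCompare` spends on each estimation. -/
def compareQueries (K η δ : ℝ) : ℕ := ⌈960 * √K * Real.log (1 / min (δ / 4) (1 / 2)) / η⌉₊

theorem log_inv_min_le {δ : ℝ} (h0 : 0 < δ) :
    Real.log (1 / min δ (1 / 2)) ≤ Real.log (1 / min (δ / 4) (1 / 2)) := by
  refine Real.log_le_log (by positivity) (one_div_le_one_div_of_le (by positivity) ?_)
  exact min_le_min_right _ (by linarith)

theorem log_inv_min_div_four_le {δ : ℝ} (h0 : 0 < δ) :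
    Real.log (1 / min (δ / 4) (1 / 2)) ≤ 5 * Real.log (1 / min δ (1 / 2)) := by
  have h1 : 0 < min δ (1 / 2) := lt_min h0 (by norm_num)
  have h2 : min δ (1 / 2) / 4 ≤ min (δ / 4) (1 / 2) :=
    le_min (by linarith [min_le_left δ (1 / 2)]) (by linarith [min_le_right δ (1 / 2)])
  have h3 : Real.log (1 / min (δ / 4) (1 / 2)) ≤ Real.log (4 * (1 / min δ (1 / 2))) := by
    refine Real.log_le_log (by positivity) ?_
    calc _ ≤ 1 / (min δ (1 / 2) / 4) := one_div_le_one_div_of_le (by positivity) h2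
      _ = _ := by field_simp
  rw [Real.log_mul (by norm_num) (by positivity), show (4 : ℝ) = 2 ^ 2 by norm_num,
    Real.log_pow] at h3
  push_cast at h3
  linarith [half_lt_log_inv h0, Real.log_two_lt_d9]

theorem le_compareQueries (K η δ : ℝ) :
    960 * √K * Real.log (1 / min (δ / 4) (1 / 2)) / η ≤ compareQueries K η δ :=
  Nat.le_ceil _

theorem le_four_mul_compareQueries {K η δ : ℝ} (hη : 0 < η) (h0 : 0 < δ) :
    1 * (√K * Real.log (1 / min δ (1 / 2)) / η) ≤ ((4 * compareQueries K η δ : ℕ) : ℝ) := by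
  have h1 := le_compareQueries K η δ
  have h2 : √K * Real.log (1 / min δ (1 / 2)) / η ≤
      √K * Real.log (1 / min (δ / 4) (1 / 2)) / η := by
    exact div_le_div_of_nonneg_right
      (mul_le_mul_of_nonneg_left (log_inv_min_le h0) (Real.sqrt_nonneg K)) hη.le
  have h3 : 0 ≤ √K * Real.log (1 / min δ (1 / 2)) / η :=
    div_nonneg (mul_nonneg (Real.sqrt_nonneg K) (by linarith [half_lt_log_inv h0])) hη.le
  have h4 : 960 * √K * Real.log (1 / min (δ / 4) (1 / 2)) / η =
    960 * (√K * Real.log (1 / min (δ / 4) (1 / 2)) / η) := by ring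
  push_cast
  linarith

theorem four_mul_compareQueries_le {K η δ : ℝ} (hK : 1 ≤ K) (hη : 0 < η) (hη1 : η < 1)
    (h0 : 0 < δ) : ((4 * compareQueries K η δ : ℕ) : ℝ) ≤
      20000 * (√K * Real.log (1 / min δ (1 / 2)) / η) := by
  have hl := half_lt_log_inv h0
  have hK1 : 1 ≤ √K := Real.one_le_sqrt.mpr hK
  have h1 : (compareQueries K η δ : ℝ) <
      960 * √K * Real.log (1 / min (δ / 4) (1 / 2)) / η + 1 := by
    refine Nat.ceil_lt_add_one (div_nonneg (mul_nonneg (by positivity) ?_) hη.le)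
    linarith [half_lt_log_inv (show 0 < δ / 4 by linarith)]
  have h2 : √K * Real.log (1 / min (δ / 4) (1 / 2)) / η ≤
      √K * (5 * Real.log (1 / min δ (1 / 2))) / η := by
    gcongr
    exact log_inv_min_div_four_le h0
  -- Absorbs the rounding of the ceiling; the total is $4(960\cdot5+2)=19208\le20000$.
  have h3 : 1 / 2 ≤ √K * Real.log (1 / min δ (1 / 2)) / η := by
    rw [le_div_iff₀ hη]
    nlinarith
  have h4 : 960 * √K * Real.log (1 / min (δ / 4) (1 / 2)) / η =
    960 * (√K * Real.log (1 / min (δ / 4) (1 / 2)) / η) := by ring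
  have h5 : √K * (5 * Real.log (1 / min δ (1 / 2))) / η =
    5 * (√K * Real.log (1 / min δ (1 / 2)) / η) := by ring
  push_cast
  linarith

/-- With `compareQueries` queries, additive estimation has error at most `η / 4`. -/
theorem le_prob_add_compareQueries [NeZero N] [NeZero T] {addEst : Estimator}
    (hadd : IsAddEstProbQCond 160 addEst) {D : Fin N → ℝ} (hD : D ∈ stdSimplex ℝ (Fin N))
    {O : OracleTable N T} (hO : Represents O D) {R S : Finset (Fin N)} (hRS : R ⊆ S)
    (hS : 0 < weight D S) {K η δ : ℝ} (hK : 1 ≤ K) (hη : 0 < η) (hη1 : η < 1) (h0 : 0 < δ)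
    (h1 : δ ≤ 1) :
    ENNReal.ofReal (1 - δ / 4) ≤ (addEst N T S R (compareQueries K η δ) (δ / 4)).prob O
      {v | |v - weight (condDist D S) R| ≤ η / 4} := by
  refine (hadd N T S R _ (δ / 4) hRS (by linarith) (by linarith)).2 D hD O hO hS (η / 4)
    (by linarith) (le_trans ?_ (le_compareQueries K η δ))
  have hl := half_lt_log_inv (show 0 < δ / 4 by linarith)
  set l := Real.log (1 / min (δ / 4) (1 / 2))
  have hK1 : 1 ≤ √K := Real.one_le_sqrt.mpr hK
  have hp : √(weight (condDist D S) R) ≤ 1 := by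
    rw [hO.weight_condDist hS]
    exact Real.sqrt_le_one.mpr (markedFraction_le_one O S R)
  have hsq : η / 4 ≤ √(η / 4) := Real.le_sqrt_of_sq_le (by nlinarith)
  have hm : max (√(weight (condDist D S) R) / (η / 4)) (1 / √(η / 4)) ≤ 1 / (η / 4) :=
    max_le (by gcongr) (one_div_le_one_div_of_le (by positivity) hsq)
  calc _ ≤ 160 * l * (1 / (η / 4)) := by gcongr
    _ = 640 * 1 * l / η := by
      field_simp
      norm_num
    _ ≤ 960 * √K * l / η := by gcongr; norm_num

/-- With `compareQueries` queries, multiplicative estimation of a weight that is not too small has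
relative error at most `η / 3`. -/
theorem le_prob_mul_compareQueries [NeZero N] [NeZero T] {mulEst : Estimator}
    (hmul : IsMulEstProbQCond 160 mulEst) {D : Fin N → ℝ} (hD : D ∈ stdSimplex ℝ (Fin N))
    {O : OracleTable N T} (hO : Represents O D) {R S : Finset (Fin N)} (hRS : R ⊆ S)
    (hS : 0 < weight D S) {K η δ : ℝ} (hK : 1 ≤ K) (hη : 0 < η) (hη1 : η < 1) (h0 : 0 < δ)
    (h1 : δ ≤ 1) :
    ENNReal.ofReal (1 - δ / 4) ≤ (mulEst N T S R (compareQueries K η δ) (δ / 4)).prob O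
      {v | 1 / (3 * K + 1) ≤ weight (condDist D S) R → v ∈ Set.Icc
        ((1 - η / 3) * weight (condDist D S) R) ((1 + η / 3) * weight (condDist D S) R)} := by
  -- The event is an implication, so it is certain for small weights and one union bound covers all
  -- cases of the comparison.
  by_cases hR : 1 / (3 * K + 1) ≤ weight (condDist D S) R
  · simp only [hR, true_imp_iff]
    have hp : 0 < weight (condDist D S) R := lt_of_lt_of_le (by positivity) hR
    refine (hmul N T S R _ (δ / 4) hRS (by linarith) (by linarith)).2 D hD O hO hS hp (η / 3)
      (by linarith) (by linarith) (le_trans ?_ (le_compareQueries K η δ))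
    have hl := half_lt_log_inv (show 0 < δ / 4 by linarith)
    set l := Real.log (1 / min (δ / 4) (1 / 2))
    set p := weight (condDist D S) R
    have hsp : 0 < √p := Real.sqrt_pos.mpr hp
    -- From $p\ge1/(3K+1)\ge1/(4K)$. With error $\eta/3$ this gives the constant
    -- $960=160\cdot3\cdot2$.
    have h2 : 1 ≤ 2 * √K * √p := by
      have h3 : 1 ≤ 4 * K * p := by
        rw [div_le_iff₀ (by positivity)] at hR
        nlinarith
      have h4 : (2 * √K * √p) ^ 2 = 4 * K * p := by
        rw [mul_pow, mul_pow, Real.sq_sqrt hp.le, Real.sq_sqrt (by linarith)]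
        ring
      rw [← h4] at h3
      exact (one_le_sq_iff₀ (by positivity)).mp h3
    rw [div_le_div_iff₀ (by positivity) hη]
    calc 160 * l * η = 160 * l * η * 1 := by ring
      _ ≤ 160 * l * η * (2 * √K * √p) := by gcongr
      _ = 960 * √K * l * (η / 3 * √p) := by ring
  · have : {v : ℝ | 1 / (3 * K + 1) ≤ weight (condDist D S) R → v ∈ Set.Icc
        ((1 - η / 3) * weight (condDist D S) R) ((1 + η / 3) * weight (condDist D S) R)} =
        Set.univ := Set.eq_univ_of_forall fun v h => absurd h hR
    rw [this, QAlg.prob, (PMF.toOuterMeasure_apply_eq_one_iff _ _).mpr (Set.subset_univ _)]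
    exact ENNReal.ofReal_le_one.mpr (by linarith)

end Compare

end

/-! ### The main theorem -/

theorem mainTheorem3 :
    ∃ (c c₁ c₂ : ℝ) (addEst mulEst : Estimator) (M : ℝ → ℝ → ℝ → ℕ),
      0 < c ∧ 0 < c₁ ∧ 0 < c₂ ∧
      IsAddEstProbQCond c addEst ∧ IsMulEstProbQCond c mulEst ∧
      ∀ K η δ : ℝ, 1 ≤ K → 0 < η → η < 3 / (8 * K) → 0 < δ → δ ≤ 1 →
        -- the total number of queries is of the order of `√K log(1/δ) / η`
        c₁ * (√K * Real.log (1 / min δ (1 / 2)) / η) ≤ ((4 * M K η δ : ℕ) : ℝ) ∧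
        ((4 * M K η δ : ℕ) : ℝ) ≤ c₂ * (√K * Real.log (1 / min δ (1 / 2)) / η) ∧
        ∀ (N T : ℕ) [NeZero N] [NeZero T] (X Y : Finset (Fin N)), Disjoint X Y →
          (qCompare addEst mulEst (M K η δ) N T X Y η K δ).MakesQueries (X ∪ Y) (4 * M K η δ) ∧
          ∀ D ∈ stdSimplex ℝ (Fin N), ∀ O : OracleTable N T,
            Represents O D → 0 < weight D (X ∪ Y) →
            (∀ v : ℝ, CompareOutput.value v ∈
              ((qCompare addEst mulEst (M K η δ) N T X Y η K δ).output O).support → 0 < v) ∧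
            (ENNReal.ofReal (1 / K) ≤ ratio D X Y ∧ ratio D X Y ≤ ENNReal.ofReal K →
              ENNReal.ofReal (1 - δ) ≤
                (qCompare addEst mulEst (M K η δ) N T X Y η K δ).prob O
                  (goodValues η (ratio D X Y))) ∧
            (ENNReal.ofReal K < ratio D X Y →
              ENNReal.ofReal (1 - δ) ≤
                (qCompare addEst mulEst (M K η δ) N T X Y η K δ).prob O
                  ({CompareOutput.high} ∪ goodValues η (ratio D X Y))) ∧
            (ratio D X Y < ENNReal.ofReal (1 / K) →
              ENNReal.ofReal (1 - δ) ≤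
                (qCompare addEst mulEst (M K η δ) N T X Y η K δ).prob O
                  ({CompareOutput.low} ∪ goodValues η (ratio D X Y))) := by
  refine ⟨160, 1, 20000, addEstProbQCond, mulEstProbQCond, compareQueries, by norm_num,
    by norm_num, by norm_num, isAddEstProbQCond_addEstProbQCond,
    isMulEstProbQCond_mulEstProbQCond, ?_⟩
  intro K η δ hK hη hηK h0 h1
  have hη1 : η < 1 := by
    refine hηK.trans ?_
    rw [div_lt_one (by positivity)]
    linarith
  refine ⟨le_four_mul_compareQueries hη h0, four_mul_compareQueries_le hK hη hη1 h0, ?_⟩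
  intro N T _ _ X Y hXY
  refine ⟨makesQueries_qCompare isAddEstProbQCond_addEstProbQCond
    isMulEstProbQCond_mulEstProbQCond _ X Y η K h0 h1, ?_⟩
  intro D hD O hO hW
  have hX := weight_nonneg hD X
  have hY := weight_nonneg hD Y
  have hsum := weight_union D hXY
  have hXs : X ⊆ X ∪ Y := Finset.subset_union_left
  have hYs : Y ⊆ X ∪ Y := Finset.subset_union_right
  have hadd := fun {R} (hR : R ⊆ X ∪ Y) => le_prob_add_compareQueries
    isAddEstProbQCond_addEstProbQCond hD hO hR hW hK hη hη1 h0 h1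
  have hmul := fun {R} (hR : R ⊆ X ∪ Y) => le_prob_mul_compareQueries
    isMulEstProbQCond_mulEstProbQCond hD hO hR hW hK hη hη1 h0 h1
  have hpX := weight_condDist_of_subset D hXs
  have hpY := weight_condDist_of_subset D hYs
  have hXY0 : 0 < weight D X + weight D Y := hsum ▸ hW
  have hK0 : 0 < K := by linarith
  have hgood : ∀ {u v : ℝ}, 1 / (3 * K + 1) ≤ weight (condDist D (X ∪ Y)) X →
      1 / (3 * K + 1) ≤ weight (condDist D (X ∪ Y)) Y →
      (1 / (3 * K + 1) ≤ weight (condDist D (X ∪ Y)) X → u ∈ Set.Icc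
        ((1 - η / 3) * weight (condDist D (X ∪ Y)) X)
        ((1 + η / 3) * weight (condDist D (X ∪ Y)) X)) →
      (1 / (3 * K + 1) ≤ weight (condDist D (X ∪ Y)) Y → v ∈ Set.Icc
        ((1 - η / 3) * weight (condDist D (X ∪ Y)) Y)
        ((1 + η / 3) * weight (condDist D (X ∪ Y)) Y)) →
      CompareOutput.value (v / u) ∈ goodValues η (ratio D X Y) := by
    intro u v hx hy hu hv
    have hu := hu hx
    have hv := hv hy
    have h3K : 0 < 1 / (3 * K + 1) := by positivity
    have hx0 := h3K.trans_le hx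
    have hy0 := h3K.trans_le hy
    rw [hpX] at hu hx0
    rw [hpY] at hv hy0
    exact value_div_mem_goodValues hη hη1 hW ((div_pos_iff_of_pos_right hW).mp hx0)
      ((div_pos_iff_of_pos_right hW).mp hy0) hu hv
  have hone : weight (condDist D (X ∪ Y)) X + weight (condDist D (X ∪ Y)) Y = 1 := by
    rw [hpX, hpY, ← add_div, ← hsum, div_self hW.ne']
  have hmulle : ∀ {k l : ℝ} {A B : Finset (Fin N)}, A ⊆ X ∪ Y → B ⊆ X ∪ Y →
      k * weight D A ≤ l * weight D B →
      k * weight (condDist D (X ∪ Y)) A ≤ l * weight (condDist D (X ∪ Y)) B := by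
    intro k l A B hA hB h
    rw [weight_condDist_of_subset D hA, weight_condDist_of_subset D hB, ← mul_div_assoc,
      ← mul_div_assoc]
    gcongr
  have hsmall : 1 / (3 * K + 1) ≤ K / (K + 1) := by
    rw [div_le_div_iff₀ (by positivity) (by positivity)]
    nlinarith
  have hbig : ∀ {x y : ℝ}, x + y = 1 → ¬ 1 / (3 * K + 1) ≤ x → 3 * K / (3 * K + 1) < y := by
    intro x y h hx
    have : 3 * K / (3 * K + 1) + 1 / (3 * K + 1) = 1 := by field_simp
    linarith [not_le.mp hx]
  have hlow : ∀ {x y : ℝ}, x + y = 1 → K * x ≤ y → x ≤ K / (K + 1) ∧ K / (K + 1) ≤ y := by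
    intro x y h hx
    rw [le_div_iff₀ (by positivity), div_le_iff₀ (by positivity)]
    constructor <;> nlinarith
  set x := weight (condDist D (X ∪ Y)) X with hxdef
  set y := weight (condDist D (X ∪ Y)) Y with hydef
  refine ⟨fun v hv => pos_of_value_mem_support_qCompare
    (fun R v hv => pos_of_mem_support_mulEstProbQCond hv) hv, ?_, ?_, ?_⟩
  · rintro ⟨hr1, hr2⟩
    rw [ofReal_le_ratio_iff hX hY hXY0, one_div_mul_eq_div, div_le_iff₀ hK0, mul_comm _ K] at hr1
    rw [ratio_le_ofReal_iff hX hXY0 hK0.le] at hr2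
    have hxy : x ≤ K * y := by
      simpa using hmulle (k := 1) hXs hYs (by simpa using hr1)
    have hyx : y ≤ K * x := by
      simpa using hmulle (k := 1) hYs hXs (by simpa using hr2)
    have hx : x ≤ K / (K + 1) := by rw [le_div_iff₀ (by positivity)]; nlinarith
    have hy : y ≤ K / (K + 1) := by rw [le_div_iff₀ (by positivity)]; nlinarith
    have hx' : 1 / (3 * K + 1) ≤ x := by rw [div_le_iff₀ (by positivity)]; nlinarith
    have hy' : 1 / (3 * K + 1) ≤ y := by rw [div_le_iff₀ (by positivity)]; nlinarith
    refine le_prob_qCompare h0.le (hadd hXs) (hadd hYs) (hmul hXs) (hmul hYs) ?_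
    intro a ha b hb u hu v hv
    rw [if_neg (not_not.mpr (estimate_le_threshold hK hηK hη hx ha)),
      if_neg (not_not.mpr (estimate_le_threshold hK hηK hη hy hb))]
    exact hgood hx' hy' hu hv
  · intro hr
    rw [← not_le, ratio_le_ofReal_iff hX hXY0 hK0.le, not_le] at hr
    have hxy : K * x ≤ y := by
      simpa using hmulle (l := 1) hXs hYs (by simpa using hr.le)
    obtain ⟨hx, hy⟩ := hlow hone hxy
    refine le_prob_qCompare h0.le (hadd hXs) (hadd hYs) (hmul hXs) (hmul hYs) ?_
    intro a ha b hb u hu v hv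
    rw [if_neg (not_not.mpr (estimate_le_threshold hK hηK hη hx ha))]
    -- Low is already excluded. If the share of `X` is too small for its multiplicative estimate,
    -- which includes $D(X)=0$, then the share of `Y` exceeds $3K/(3K+1)$ and forces High.
    by_cases hx' : 1 / (3 * K + 1) ≤ x
    · split_ifs
      · exact Or.inr (hgood hx' (hsmall.trans hy) hu hv)
      · exact Or.inl rfl
    · rw [if_pos (threshold_lt_estimate hη (hbig hone hx') hb)]
      exact Or.inl rfl
  · intro hr
    rw [← not_le, ofReal_le_ratio_iff hX hY hXY0, not_le, one_div_mul_eq_div, lt_div_iff₀ hK0,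
      mul_comm _ K] at hr
    have hyx : K * y ≤ x := by
      simpa using hmulle (l := 1) hYs hXs (by simpa using hr.le)
    have hone' : y + x = 1 := by rw [add_comm]; exact hone
    obtain ⟨hy, hx⟩ := hlow hone' hyx
    refine le_prob_qCompare h0.le (hadd hXs) (hadd hYs) (hmul hXs) (hmul hYs) ?_
    intro a ha b hb u hu v hv
    -- Mirror image, except that Low is tested first: a small share of `Y` forces Low whatever the
    -- estimate for `Y`.
    by_cases hy' : 1 / (3 * K + 1) ≤ y
    · rw [if_neg (not_not.mpr (estimate_le_threshold hK hηK hη hy hb))]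
      split_ifs
      · exact Or.inr (hgood (hsmall.trans hx) hy' hu hv)
      · exact Or.inl rfl
    · rw [if_pos (threshold_lt_estimate hη (hbig hone' hy') ha)]
      exact Or.inl rfl
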